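/- All graphs are finite and simple. The distance between two edges of a graph $G$ is the distance between the corresponding vertices of the line graph of $G$. A strong clique of $G$ is a set of edges of $G$ such that every two of them are at distance at most $2$, and the strong clique number $\mathrm{SC}(G)$ is the number of edges of a maximum strong clique of $G$. Let $\Delta(G)$ be the maximum degree of $G$, let $C_n$ be the cycle on $n$ vertices, and call $G$ $F$-free if $G$ has no (not necessarily induced) subgraph isomorphic to $F$; $G$ is $\{F_1,F_2\}$-free if it is both $F_1$-free and $F_2$-free. Let $k\ge 2$ be an integer, and let $G$ be a $\{C_5,C_{2k}\}$-free graph with $\Delta(G)\ge 1$. Then: (i) if $k\ge 4$, then $\mathrm{SC}(G)\le k\Delta(G)-(k-1)$; (ii) if $k\in\{2,3\}$ and $G$ is also $C_3$-free, then $\mathrm{SC}(G)\le k\Delta(G)-(k-1)$. -/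

import Mathlib

namespace SimpleGraph

/-- A strong clique of `G`: a set of edges of `G` that are pairwise at distance at most `2`, where
the distance of two edges is their distance in the line graph of `G` (it is `⊤` if no walk of the
line graph joins them). -/
def IsStrongClique {V : Type*} (G : SimpleGraph V) (S : Finset G.edgeSet) : Prop :=
  ∀ e ∈ S, ∀ f ∈ S, G.lineGraph.edist e f ≤ 2

/-- The strong clique number of `G`: the number of edges of a maximum strong clique. -/
noncomputable def strongCliqueNum {V : Type*} (G : SimpleGraph V) : ℕ :=
  sSup {n : ℕ | ∃ S : Finset G.edgeSet, G.IsStrongClique S ∧ S.card = n}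

/-- In a finite graph, the strong clique number is attained and is the maximum. -/
theorem strongCliqueNum_isGreatest {V : Type*} [Finite V] (G : SimpleGraph V) :
    IsGreatest {n : ℕ | ∃ S : Finset G.edgeSet, G.IsStrongClique S ∧ S.card = n}
      G.strongCliqueNum := by
  have := Fintype.ofFinite G.edgeSet
  have hb : BddAbove {n : ℕ | ∃ S : Finset G.edgeSet, G.IsStrongClique S ∧ S.card = n} :=
    ⟨Fintype.card G.edgeSet, by rintro n ⟨S, -, rfl⟩; exact S.card_le_univ⟩
  have hn : {n : ℕ | ∃ S : Finset G.edgeSet, G.IsStrongClique S ∧ S.card = n}.Nonempty :=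
    ⟨0, ∅, by simp [IsStrongClique], rfl⟩
  exact ⟨Nat.sSup_mem hn hb, fun n h => le_csSup hb h⟩

end SimpleGraph

/-!
A strong clique is handled as a symmetric relation `P` on the vertices (`IsStrongCliqueRel`).

The first half of the argument makes `P` bipartite. In a `C_5`-free graph, either the edges of `P`
can be directed from a set of tails to a disjoint set of heads such that any two directed edges
`a → b`, `a' → b'` satisfy `ab' ∈ E(G)` or `a'b ∈ E(G)` (`HasBipartition`), or `P` is covered by a
star with at most three leaves (`StarCover`), and then `G` has a triangle
(`IsStrongCliqueRel.hasBipartition_or_starCover`). A star cover gives at most `4Δ - 3` edges, since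
each leaf contributes at most `Δ - 1` edges beyond those at the centre; this is enough for `k ≥ 4`,
and it does not occur in triangle-free graphs. To find the bipartition, fix an edge `xy` of `P` and
direct the other edges into `N(x)` or out of `N(y)`. Every edge of `P` is close to `xy`, and two
edges violating the conditions close a five-cycle, or a triangle whose vicinity is so rigid that all
of `P` meets a small star. If an edge of `P` lies in a triangle, `xy` is taken to be such an edge
(`TriangleEdge.hasBipartition`); otherwise any edge will do
(`IsStrongCliqueRel.hasBipartition_of_no_triangle_edge`).

The second half bounds a set `E` of directed edges as above (`IsCrossing.card_add_le`). On a matching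
of `E`, the relation "the tail of `e` is adjacent to the head of `f`" is a semicomplete digraph. A
directed `k`-cycle in it gives a `C_{2k}` in `G`, and so does a path on `k + 1` vertices whose first
vertex dominates its last one. For `k ≥ 3`, any `k + 1` vertices contain one or the other
(`exists_cycle_or_shortcut_path`), so by König's theorem `E` has a vertex cover of at most `k`
vertices. For `k = 2` the exception is a cyclic triangle, which turns out to be all of `E`.

Counting over a minimum cover of size `t ≤ k` gives `tΔ`, and `t - 1` has to be saved. A vertex of the
cover that lies on fewer than `Δ` edges of `E` saves one. A vertex on exactly `Δ` edges of `E` is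
joined by an edge of `E` to every vertex on the opposite side (`IsCrossing.mem_of_full`). If the cover
has vertices on both sides, the edges inside the cover, which are counted twice, therefore save
enough. If it lies on one side and contains a full vertex, then all of `E` lies between the cover and
`Δ` vertices; this settles `t < k`, and for `t = k` the matching has no directed Hamilton cycle,
hence misses at least `k - 1` ordered pairs (`card_not_rel_of_no_hamilton_cycle`).
-/

namespace SimpleGraph

/-! ### Cycles as sequences of vertices -/

/-- A cyclic sequence of `n` distinct, consecutively adjacent vertices is a copy of `C_n`. -/
theorem cycleGraph_isContained_of_seq {V : Type*} {G : SimpleGraph V} {n : ℕ} (f : ℕ → V)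
    (hinj : ∀ i < n, ∀ j < n, f i = f j → i = j)
    (hstep : ∀ i, i + 1 < n → G.Adj (f i) (f (i + 1)))
    (hlast : G.Adj (f (n - 1)) (f 0)) : cycleGraph n ⊑ G := by
  have key : ∀ u v : Fin n, (u - v).val = 1 → G.Adj (f v) (f u) := by
    intro u v huv
    have hu := u.isLt
    have hv := v.isLt
    rw [Fin.sub_def] at huv
    simp only at huv
    have hcases : (u : ℕ) = v + 1 ∨ ((v : ℕ) = n - 1 ∧ (u : ℕ) = 0) := by
      rcases Nat.lt_or_ge (n - v + u) n with h | h
      · rw [Nat.mod_eq_of_lt h] at huv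
        omega
      · rw [Nat.mod_eq_sub_mod h] at huv
        rcases Nat.lt_or_ge (n - v + u - n) n with h' | h'
        · rw [Nat.mod_eq_of_lt h'] at huv
          omega
        · omega
    rcases hcases with h | ⟨h, h'⟩
    · rw [h]
      exact hstep _ (h ▸ hu)
    · rw [h, h']
      exact hlast
  refine ⟨⟨⟨fun i => f i, ?_⟩, ?_⟩⟩
  · intro u v huv
    rcases cycleGraph_adj'.mp huv with h | h
    · exact (key _ _ h).symm
    · exact key _ _ h
  · intro u v huv
    exact Fin.ext (hinj _ u.isLt _ v.isLt huv)

/-- In a triangle-free graph no three vertices are pairwise adjacent. -/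
theorem Free.no_triangle {V : Type*} {G : SimpleGraph V} (h : (cycleGraph 3).Free G) {a b c : V}
    (hab : G.Adj a b) (hbc : G.Adj b c) (hca : G.Adj c a) : False := by
  have := hab.ne
  have := hbc.ne
  have := hca.ne
  refine h (cycleGraph_isContained_of_seq (fun i => if i = 0 then a else if i = 1 then b else c)
    ?_ ?_ ?_)
  · intro i hi j hj
    interval_cases i <;> interval_cases j <;> simp <;> grind
  · intro i hi
    have : i = 0 ∨ i = 1 := by omega
    rcases this with rfl | rfl <;> simpa
  · simpa

/-- In a `C_5`-free graph a closed walk of length five has a repeated vertex. -/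
theorem Free.five_cycle {V : Type*} {G : SimpleGraph V} (h : (cycleGraph 5).Free G)
    (a b c d e : V) (hab : G.Adj a b) (hbc : G.Adj b c) (hcd : G.Adj c d) (hde : G.Adj d e)
    (hea : G.Adj e a) : a = c ∨ a = d ∨ b = d ∨ b = e ∨ c = e := by
  by_contra! hne
  obtain ⟨h1, h2, h3, h4, h5⟩ := hne
  have := hab.ne
  have := hbc.ne
  have := hcd.ne
  have := hde.ne
  have := hea.ne
  refine h (cycleGraph_isContained_of_seq (fun i => if i = 0 then a else if i = 1 then b else
    if i = 2 then c else if i = 3 then d else e) ?_ ?_ ?_)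
  · intro i hi j hj
    interval_cases i <;> interval_cases j <;> simp <;> grind
  · intro i hi
    have : i = 0 ∨ i = 1 ∨ i = 2 ∨ i = 3 := by omega
    rcases this with rfl | rfl | rfl | rfl <;> simpa
  · simpa

/-- An alternating cyclic sequence `p 0, q 0, p 1, q 1, …, p (k - 1), q (k - 1)` of distinct
vertices is a copy of `C_{2k}`. -/
theorem cycleGraph_isContained_of_alternating {V : Type*} {G : SimpleGraph V} {k : ℕ} (hk : 0 < k)
    (p q : ℕ → V) (hp : ∀ i < k, ∀ j < k, p i = p j → i = j)
    (hq : ∀ i < k, ∀ j < k, q i = q j → i = j) (hpq : ∀ i < k, ∀ j < k, p i ≠ q j)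
    (h₁ : ∀ i < k, G.Adj (p i) (q i)) (h₂ : ∀ i, i + 1 < k → G.Adj (q i) (p (i + 1)))
    (h₃ : G.Adj (q (k - 1)) (p 0)) : cycleGraph (2 * k) ⊑ G := by
  refine cycleGraph_isContained_of_seq (fun i => if i % 2 = 0 then p (i / 2) else q (i / 2))
    ?_ ?_ ?_
  · intro i hi j hj hij
    split_ifs at hij with hi2 hj2 hj2
    · have := hp _ (by omega) _ (by omega) hij
      omega
    · exact absurd hij (hpq _ (by omega) _ (by omega))
    · exact absurd hij.symm (hpq _ (by omega) _ (by omega))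
    · have := hq _ (by omega) _ (by omega) hij
      omega
  · intro i hi
    rcases Nat.mod_two_eq_zero_or_one i with h | h
    · have h' : (i + 1) % 2 = 1 := by omega
      have h'' : (i + 1) / 2 = i / 2 := by omega
      simp only [h, h', h'', if_true, one_ne_zero, if_false]
      exact h₁ _ (by omega)
    · have h' : (i + 1) % 2 = 0 := by omega
      have h'' : (i + 1) / 2 = i / 2 + 1 := by omega
      simp only [h, h', h'', if_true, one_ne_zero, if_false]
      exact h₂ _ (by omega)
  · have h' : (2 * k - 1) % 2 = 1 := by omega
    have h'' : (2 * k - 1) / 2 = k - 1 := by omega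
    simpa only [h', h'', if_true, one_ne_zero, if_false, Nat.zero_mod, Nat.zero_div] using h₃

/-! ### Strong cliques as edge relations -/

/-- The symmetric relation on vertices encoding a strong clique: `P u v` says that `uv` is an edge
of the clique, and any two edges of the clique share a vertex or are joined by an edge of `G`. -/
structure IsStrongCliqueRel {V : Type*} (G : SimpleGraph V) (P : V → V → Prop) : Prop where
  symm : ∀ {u v}, P u v → P v u
  adj : ∀ {u v}, P u v → G.Adj u v
  conn : ∀ {u v x y}, P u v → P x y → u = x ∨ u = y ∨ v = x ∨ v = y ∨
    G.Adj u x ∨ G.Adj u y ∨ G.Adj v x ∨ G.Adj v y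

/-- Every edge of `P` meets a star of `G` with centre `c` and at most three leaves; the leaves need
not be distinct. -/
def StarCover {V : Type*} (G : SimpleGraph V) (P : V → V → Prop) : Prop :=
  ∃ c p q r, G.Adj c p ∧ G.Adj c q ∧ G.Adj c r ∧
    ∀ u v, P u v → u = c ∨ u = p ∨ u = q ∨ u = r ∨ v = c ∨ v = p ∨ v = q ∨ v = r

/-- The edges of `P` can be directed by `O` so that no vertex is both a tail and a head, and so that
any two edges `a → b` and `a' → b'` satisfy `ab' ∈ E(G)` or `a'b ∈ E(G)`. Thus `P` behaves like a
strong clique of a bipartite graph. -/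
def HasBipartition {V : Type*} (G : SimpleGraph V) (P : V → V → Prop) : Prop :=
  ∃ O : V → V → Prop, (∀ a b, O a b → P a b) ∧ (∀ a b, P a b → O a b ∨ O b a) ∧
    ∀ a b a' b', O a b → O a' b' → a ≠ b' ∧ (G.Adj a b' ∨ G.Adj a' b)

section Reduction

variable {V : Type*} {G : SimpleGraph V} {P : V → V → Prop}

/-- If two edges of `P` outside a triangle `xyz` have ends `u ∼ x, y` and `u' ∼ x`, then they
meet in `u`. -/
theorem IsStrongCliqueRel.eq_of_two_attachments (hP : G.IsStrongCliqueRel P)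
    (h5 : (cycleGraph 5).Free G) {x y z u v u' v' : V} (hxy : G.Adj x y) (hxz : G.Adj x z)
    (hyz : G.Adj y z) (huv : P u v) (huv' : P u' v') (hux : G.Adj u x) (huy : G.Adj u y)
    (hux' : G.Adj u' x) (hv : v ≠ x ∧ v ≠ y ∧ v ≠ z) (hu : u ≠ z)
    (hu' : u' ≠ y ∧ u' ≠ z) (hv' : v' ≠ x ∧ v' ≠ y ∧ v' ≠ z) : u' = u ∨ v' = u := by
  have a1 := hP.adj huv
  have a2 := hP.adj huv'
  have i1 := hxy.ne
  have i2 := hxz.ne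
  have i3 := hyz.ne
  by_contra! hne
  have k1 := hux.ne
  have k2 := huy.ne
  have k3 := hux'.ne
  have k4 := a1.ne
  have k5 := a2.ne
  have n1 : ¬ G.Adj v x := fun h => by
    have := h5.five_cycle u v x z y a1 h hxz hyz.symm huy.symm
    grind
  rcases hP.conn huv huv' with h | h | h | h | h | h | h | h
  · grind
  · grind
  · exact n1 (h ▸ hux')
  · have := h5.five_cycle u v u' x y a1 (h ▸ a2.symm) hux' hxy huy.symm
    grind
  · have := h5.five_cycle u u' x z y h hux' hxz hyz.symm huy.symm
    grind
  · have := h5.five_cycle u v' u' x y h a2.symm hux' hxy huy.symm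
    grind
  · have := h5.five_cycle u v u' x y a1 h hux' hxy huy.symm
    grind
  · have := h5.five_cycle u v v' u' x a1 h a2.symm hux' hux.symm
    grind [G.loopless]

/-! ### Strong cliques without edges in triangles -/

/-- Suppose no edge of `P` lies in a triangle, and `P` has an edge pendant at each vertex of a
triangle. Every other edge of `P` then has an end adjacent to all three vertices of the
triangle, and this end is the same for all of them. -/
theorem IsStrongCliqueRel.starCover_of_pendant_triangle (hP : G.IsStrongCliqueRel P)
    (h5 : (cycleGraph 5).Free G) (hT : ∀ x y z, P x y → G.Adj x z → G.Adj y z → False)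
    {t₁ t₂ t₃ s₁ s₂ s₃ : V} (h₁₂ : G.Adj t₁ t₂) (h₁₃ : G.Adj t₁ t₃) (h₂₃ : G.Adj t₂ t₃)
    (p₁ : P t₁ s₁) (p₂ : P t₂ s₂) (p₃ : P t₃ s₃) : G.StarCover P := by
  -- Below, `uv` is an edge of `P` disjoint from the triangle `abc`.
  -- No end of `uv` is the far end of a pendant edge.
  have notEnd : ∀ {a b c s s' u v}, G.Adj a b → G.Adj a c → G.Adj b c → P a s → P b s' →
      P u v → u ≠ a → u ≠ b → u ≠ c → v ≠ a → v ≠ b → v ≠ c → u ≠ s := by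
    rintro a b c s s' u v hab hac hbc ps ps' huv ua ub uc va vb vc rfl
    have e1 := hP.adj ps
    have e2 := hP.adj ps'
    have e3 := hP.adj huv
    have d1 := hab.ne
    have d2 := hac.ne
    have d3 := hbc.ne
    have d4 := e1.ne
    have d5 := e2.ne
    have n1 : ¬ G.Adj u b := fun h => hT _ _ _ ps hab h
    have n2 : ¬ G.Adj s' a := fun h => hT _ _ _ ps' hab.symm h
    have n3 : s' ≠ c := fun h => hT _ _ _ (h ▸ ps') hab.symm hac.symm
    have n4 : ¬ G.Adj u s' := fun h => by
      have := h5.five_cycle u s' b c a h e2.symm hbc hac.symm e1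
      grind [G.adj_comm]
    rcases hP.conn huv ps' with h | h | h | h | h | h | h | h
    · exact ub h
    · exact n1 (h ▸ e2.symm)
    · exact vb h
    · exact n4 (h ▸ e3)
    · exact n1 h
    · exact n4 h
    · have := h5.five_cycle u v b c a e3 h hbc hac.symm e1
      grind
    · have := h5.five_cycle u v s' b a e3 h e2.symm hab.symm e1
      grind [G.adj_comm]
  -- Nor is it adjacent to one: `u ∼ s` would force `v` to be adjacent to the two other far ends.
  have far : ∀ {a b c s s' s'' u v}, G.Adj a b → G.Adj a c → G.Adj b c → P a s → P b s' →
      P c s'' → P u v → u ≠ a → u ≠ b → u ≠ c → v ≠ a → v ≠ b → v ≠ c → u ≠ s → u ≠ s' →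
      u ≠ s'' → v ≠ s → v ≠ s' → v ≠ s'' → ¬ G.Adj u s := by
    intro a b c s s' s'' u v hab hac hbc ps ps' ps'' huv ua ub uc va vb vc us us' us'' vs vs' vs'' h
    have e1 := hP.adj ps
    have e2 := hP.adj ps'
    have e2' := hP.adj ps''
    have e3 := hP.adj huv
    have d1 := hab.ne
    have d2 := hac.ne
    have d3 := hbc.ne
    have n2 : s' ≠ a := fun h => hT _ _ _ (h ▸ ps') hbc hac
    have n3 : s' ≠ c := fun h => hT _ _ _ (h ▸ ps') hab.symm hac.symm
    have n2' : s'' ≠ a := fun h => hT _ _ _ (h ▸ ps'') hbc.symm hab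
    have n3' : s'' ≠ b := fun h => hT _ _ _ (h ▸ ps'') hac.symm hab.symm
    have n4 : s ≠ b := fun h => hT _ _ _ (h ▸ ps) hac hbc
    have n5 : s ≠ c := fun h => hT _ _ _ (h ▸ ps) hab hbc.symm
    have n6 : s ≠ s' := fun h => hT _ _ _ ps hab (h ▸ e2.symm)
    have n7 : s ≠ s'' := fun h => hT _ _ _ ps hac (h ▸ e2'.symm)
    have n8 : s' ≠ s'' := fun h => hT _ _ _ ps' hbc (h ▸ e2'.symm)
    have step : ∀ {b c s'}, G.Adj a b → G.Adj a c → G.Adj b c → P b s' → u ≠ b → u ≠ c → v ≠ b →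
        u ≠ s' → v ≠ s' → s' ≠ a → s ≠ b → s ≠ c → s ≠ s' → G.Adj v s' := by
      intro b c s' hab hac hbc ps' ub uc vb us' vs' _ _ _ _
      have e2 := hP.adj ps'
      have d1 := hab.ne
      have d3 := hbc.ne
      have d4 := hac.ne
      have d5 := e1.ne
      rcases hP.conn huv ps' with h' | h' | h' | h' | h' | h' | h' | h'
      · grind
      · grind
      · grind
      · grind
      · have := h5.five_cycle u s a c b h e1.symm hac hbc.symm h'.symm
        grind
      · have := h5.five_cycle u s a b s' h e1.symm hab e2 h'.symm
        grind
      · have := h5.five_cycle u s a b v h e1.symm hab h'.symm e3.symm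
        grind
      · exact h'
    have f1 := step hab hac hbc ps' ub uc vb us' vs' n2 n4 n5 n6
    have f2 := step hac hab hbc.symm ps'' uc ub vc us'' vs'' n2' n5 n4 n7
    have := h5.five_cycle v s' b c s'' f1 e2.symm hbc e2' f2.symm
    grind
  -- So `uv` is joined to each pendant edge at the vertex of the triangle, ...
  have touch : ∀ {a s u v}, P a s → P u v → u ≠ a → v ≠ a → u ≠ s → v ≠ s → ¬ G.Adj u s →
      ¬ G.Adj v s → G.Adj u a ∨ G.Adj v a := by
    intro a s u v ps huv _ _ _ _ _ _
    rcases hP.conn huv ps with h | h | h | h | h | h | h | h <;> grind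
  -- ... and the two ends of `uv` are not attached to different vertices of the triangle.
  have spread : ∀ {a b c u v}, G.Adj a b → G.Adj a c → G.Adj b c → P u v →
      u ≠ a → u ≠ b → u ≠ c → v ≠ a → v ≠ b → v ≠ c → G.Adj u a → ¬ G.Adj v b := by
    intro a b c u v hab hac hbc huv ua ub uc va vb vc h h'
    have := h5.five_cycle u a c b v h hac hbc.symm h'.symm (hP.adj huv).symm
    have := hab.ne
    grind
  have main : ∀ {u v}, P u v → u ≠ t₁ → u ≠ t₂ → u ≠ t₃ → v ≠ t₁ → v ≠ t₂ → v ≠ t₃ →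
      (G.Adj u t₁ ∧ G.Adj u t₂ ∧ G.Adj u t₃) ∨ (G.Adj v t₁ ∧ G.Adj v t₂ ∧ G.Adj v t₃) := by
    intro u v huv u1 u2 u3 v1 v2 v3
    have hvu := hP.symm huv
    have us1 := notEnd h₁₂ h₁₃ h₂₃ p₁ p₂ huv u1 u2 u3 v1 v2 v3
    have us2 := notEnd h₂₃ h₁₂.symm h₁₃.symm p₂ p₃ huv u2 u3 u1 v2 v3 v1
    have us3 := notEnd h₁₃.symm h₂₃.symm h₁₂ p₃ p₁ huv u3 u1 u2 v3 v1 v2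
    have vs1 := notEnd h₁₂ h₁₃ h₂₃ p₁ p₂ hvu v1 v2 v3 u1 u2 u3
    have vs2 := notEnd h₂₃ h₁₂.symm h₁₃.symm p₂ p₃ hvu v2 v3 v1 u2 u3 u1
    have vs3 := notEnd h₁₃.symm h₂₃.symm h₁₂ p₃ p₁ hvu v3 v1 v2 u3 u1 u2
    have w1 := touch p₁ huv u1 v1 us1 vs1
      (far h₁₂ h₁₃ h₂₃ p₁ p₂ p₃ huv u1 u2 u3 v1 v2 v3 us1 us2 us3 vs1 vs2 vs3)
      (far h₁₂ h₁₃ h₂₃ p₁ p₂ p₃ hvu v1 v2 v3 u1 u2 u3 vs1 vs2 vs3 us1 us2 us3)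
    have w2 := touch p₂ huv u2 v2 us2 vs2
      (far h₂₃ h₁₂.symm h₁₃.symm p₂ p₃ p₁ huv u2 u3 u1 v2 v3 v1 us2 us3 us1 vs2 vs3 vs1)
      (far h₂₃ h₁₂.symm h₁₃.symm p₂ p₃ p₁ hvu v2 v3 v1 u2 u3 u1 vs2 vs3 vs1 us2 us3 us1)
    have w3 := touch p₃ huv u3 v3 us3 vs3
      (far h₁₃.symm h₂₃.symm h₁₂ p₃ p₁ p₂ huv u3 u1 u2 v3 v1 v2 us3 us1 us2 vs3 vs1 vs2)
      (far h₁₃.symm h₂₃.symm h₁₂ p₃ p₁ p₂ hvu v3 v1 v2 u3 u1 u2 vs3 vs1 vs2 us3 us1 us2)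
    rcases w1 with w | w
    · have := spread h₁₂ h₁₃ h₂₃ huv u1 u2 u3 v1 v2 v3 w
      have := spread h₁₃ h₁₂ h₂₃.symm huv u1 u3 u2 v1 v3 v2 w
      exact Or.inl ⟨w, by tauto, by tauto⟩
    · have := spread h₁₂ h₁₃ h₂₃ hvu v1 v2 v3 u1 u2 u3 w
      have := spread h₁₃ h₁₂ h₂₃.symm hvu v1 v3 v2 u1 u3 u2 w
      exact Or.inr ⟨w, by tauto, by tauto⟩
  by_cases hex : ∃ u v, P u v ∧ u ≠ t₁ ∧ u ≠ t₂ ∧ u ≠ t₃ ∧ v ≠ t₁ ∧ v ≠ t₂ ∧ v ≠ t₃ ∧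
      G.Adj u t₁ ∧ G.Adj u t₂
  · obtain ⟨u, v, huv, u1, u2, u3, v1, v2, v3, a1, a2⟩ := hex
    refine ⟨t₁, t₂, t₃, u, h₁₂, h₁₃, a1.symm, fun u' v' h => ?_⟩
    by_contra! hne
    obtain ⟨b1, b2, b3, b4, b5, b6, b7, b8⟩ := hne
    rcases main h b1 b2 b3 b5 b6 b7 with w | w
    · have := hP.eq_of_two_attachments h5 h₁₂ h₁₃ h₂₃ huv h a1 a2 w.1 ⟨v1, v2, v3⟩ u3 ⟨b2, b3⟩
        ⟨b5, b6, b7⟩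
      tauto
    · have := hP.eq_of_two_attachments h5 h₁₂ h₁₃ h₂₃ huv (hP.symm h) a1 a2 w.1 ⟨v1, v2, v3⟩ u3
        ⟨b6, b7⟩ ⟨b1, b2, b3⟩
      tauto
  · refine ⟨t₁, t₂, t₃, t₃, h₁₂, h₁₃, h₁₃, fun u' v' h => ?_⟩
    by_contra! hne
    obtain ⟨b1, b2, b3, b4, b5, b6, b7, b8⟩ := hne
    rcases main h b1 b2 b3 b5 b6 b7 with w | w
    · exact hex ⟨u', v', h, b1, b2, b3, b5, b6, b7, w.1, w.2.1⟩
    · exact hex ⟨v', u', hP.symm h, b5, b6, b7, b1, b2, b3, w.1, w.2.1⟩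

/-- If no edge of `P` lies in a triangle, then `P` has a bipartition unless it is covered by a star
and `G` has a triangle. For a fixed edge `xy` of `P`, edges are directed into `N(x)` and out of `N(y)`. -/
theorem IsStrongCliqueRel.hasBipartition_of_no_triangle_edge (hP : G.IsStrongCliqueRel P)
    (h5 : (cycleGraph 5).Free G) (hT : ∀ x y z, P x y → G.Adj x z → G.Adj y z → False) :
    G.HasBipartition P ∨ (G.StarCover P ∧ ∃ a b c, G.Adj a b ∧ G.Adj b c ∧ G.Adj c a) := by
  by_cases hne : ∃ x y, P x y
  swap
  · push Not at hne
    exact Or.inl ⟨P, fun a b h => h, fun a b h => Or.inl h, fun a b _ _ h => absurd h (hne a b)⟩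
  obtain ⟨x, y, hxy⟩ := hne
  refine or_iff_not_imp_right.mpr fun hS => ?_
  have hpend : ∀ {t₁ t₂ t₃ s₁ s₂ s₃}, G.Adj t₁ t₂ → G.Adj t₁ t₃ → G.Adj t₂ t₃ → P t₁ s₁ →
      P t₂ s₂ → P t₃ s₃ → False := fun h₁ h₂ h₃ q₁ q₂ q₃ =>
    hS ⟨hP.starCover_of_pendant_triangle h5 hT h₁ h₂ h₃ q₁ q₂ q₃, _, _, _, h₁, h₃, h₂.symm⟩
  have exy := hP.adj hxy
  have hyx := hP.symm hxy
  have dxy := exy.ne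
  -- Two edges directed into the neighbourhood of the same vertex `x`.
  have same : ∀ {x y a b a' b'}, P x y → P a b → P a' b' → G.Adj b x → G.Adj b' x →
      a ≠ b' ∧ (G.Adj a b' ∨ G.Adj a' b) := by
    intro x y a b a' b' hxy hab hab' hb hb'
    have e1 := hP.adj hab
    have e2 := hP.adj hab'
    have k1 : a ≠ b' := fun h => hT _ _ _ hab (h ▸ hb') hb
    have k2 : a' ≠ b := fun h => hT _ _ _ hab' (h ▸ hb) hb'
    refine ⟨k1, ?_⟩
    rcases hP.conn hab hab' with h | h | h | h | h | h | h | h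
    · exact Or.inl (h ▸ e2)
    · exact absurd h k1
    · exact absurd h.symm k2
    · exact Or.inl (h ▸ e1)
    · have n1 : a ≠ x := fun e => hT _ _ _ hab' (e ▸ h.symm) hb'
      have n2 : a' ≠ x := fun e => hT _ _ _ hab (e ▸ h) hb
      have := h5.five_cycle a b x b' a' e1 hb hb'.symm e2.symm h.symm
      grind
    · exact Or.inl h
    · exact Or.inr h.symm
    · exact (hpend hb.symm hb'.symm h hxy (hP.symm hab) (hP.symm hab')).elim
  -- An edge directed into `N(x)` and one directed out of `N(y)`.
  have cross : ∀ {a b a' b'}, P a b → P a' b' → G.Adj b x → G.Adj a' y →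
      a ≠ b' ∧ (G.Adj a b' ∨ G.Adj a' b) := by
    intro a b a' b' hab hab' hb ha'
    have e1 := hP.adj hab
    have e2 := hP.adj hab'
    have k0 : b ≠ a' := fun h => hT _ _ _ hxy hb.symm (h ▸ ha'.symm)
    have ay : a ≠ y := fun h => hT _ _ _ (h ▸ hab) exy.symm hb
    have b'x : b' ≠ x := fun h => hT _ _ _ (h ▸ hab') ha' exy
    have k1 : a ≠ b' := by
      rintro rfl
      have n1 : b ≠ y := fun h => hT _ _ _ (h ▸ hab) e2.symm ha'.symm
      have n2 : a' ≠ x := fun h => hT _ _ _ hab (h ▸ e2.symm) hb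
      have := h5.five_cycle x b a a' y hb.symm e1.symm e2.symm ha' exy.symm
      grind
    refine ⟨k1, ?_⟩
    by_cases hby : b = y
    · exact Or.inr (hby ▸ ha')
    by_cases ha'x : a' = x
    · exact Or.inr (ha'x ▸ hb.symm)
    rcases hP.conn hab hab' with h | h | h | h | h | h | h | h
    · exact Or.inr (h ▸ e1)
    · exact absurd h k1
    · exact absurd h k0
    · exact Or.inl (h ▸ e1)
    · have n1 : a ≠ x := fun e => hT _ _ _ hxy (e ▸ h) ha'.symm
      have := h5.five_cycle a a' y x b h ha' exy.symm hb.symm e1.symm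
      grind
    · exact Or.inl h
    · exact Or.inr h.symm
    · have n1 : b' ≠ y := fun e => hT _ _ _ hxy hb.symm (e ▸ h.symm)
      have := h5.five_cycle b b' a' y x h e2.symm ha' exy.symm hb.symm
      grind
  refine ⟨fun a b => P a b ∧ (G.Adj b x ∨ G.Adj a y), fun a b h => h.1, fun a b h => ?_, ?_⟩
  · have e := hP.adj h
    have h' := hP.symm h
    rcases hP.conn h hxy with c | c | c | c | c | c | c | c
    · exact Or.inl ⟨h, Or.inl (c ▸ e.symm)⟩
    · exact Or.inr ⟨h', Or.inr (c ▸ e.symm)⟩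
    · exact Or.inr ⟨h', Or.inl (c ▸ e)⟩
    · exact Or.inl ⟨h, Or.inr (c ▸ e)⟩
    · exact Or.inr ⟨h', Or.inl c⟩
    · exact Or.inl ⟨h, Or.inr c⟩
    · exact Or.inl ⟨h, Or.inl c⟩
    · exact Or.inr ⟨h', Or.inr c⟩
  · rintro a b a' b' ⟨hab, h⟩ ⟨hab', h'⟩
    rcases h with h | h <;> rcases h' with h' | h'
    · exact same hxy hab hab' h h'
    · exact cross hab hab' h h'
    · exact ⟨fun e => hT _ _ _ hxy h'.symm (e ▸ h.symm), (cross hab' hab h' h).2.symm⟩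
    · have := same hyx (hP.symm hab) (hP.symm hab') h h'
      have := same hyx (hP.symm hab') (hP.symm hab) h' h
      grind [G.adj_comm]

/-! ### Strong cliques with an edge in a triangle -/

/-- The edge `xy` of the strong clique `P` lies in the triangle `xyz` of the `C_5`-free graph `G`,
and `P` is not covered by a star with at most three leaves. -/
structure TriangleEdge (G : SimpleGraph V) (P : V → V → Prop) (x y z : V) : Prop where
  rel : G.IsStrongCliqueRel P
  free : (cycleGraph 5).Free G
  edge : P x y
  adj_xz : G.Adj x z
  adj_yz : G.Adj y z
  noStar : ¬ G.StarCover P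

/-- The edge `uv` of `P` is disjoint from `{x, y, z}`. In comments such an edge is called outer, and
attached to a vertex `w` of the triangle if one of its ends is adjacent to `w`. -/
structure OuterEdge (P : V → V → Prop) (x y z u v : V) : Prop where
  edge : P u v
  left : u ≠ x ∧ u ≠ y ∧ u ≠ z
  right : v ≠ x ∧ v ≠ y ∧ v ≠ z

namespace TriangleEdge

variable {x y z u v u' v' p q : V}

theorem swap (T : G.TriangleEdge P x y z) : G.TriangleEdge P y x z :=
  ⟨T.rel, T.free, T.rel.symm T.edge, T.adj_yz, T.adj_xz, T.noStar⟩

theorem adj_xy (T : G.TriangleEdge P x y z) : G.Adj x y := T.rel.adj T.edge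

theorem outer_swap (h : OuterEdge P x y z u v) : OuterEdge P y x z u v :=
  ⟨h.edge, ⟨h.left.2.1, h.left.1, h.left.2.2⟩, ⟨h.right.2.1, h.right.1, h.right.2.2⟩⟩

theorem outer_symm (T : G.TriangleEdge P x y z) (h : OuterEdge P x y z u v) :
    OuterEdge P x y z v u := ⟨T.rel.symm h.edge, h.right, h.left⟩

theorem attach (T : G.TriangleEdge P x y z) (h : OuterEdge P x y z u v) :
    G.Adj u x ∨ G.Adj u y ∨ G.Adj v x ∨ G.Adj v y := by
  have := T.rel.conn h.edge T.edge
  have := h.left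
  have := h.right
  tauto

theorem exists_outer (T : G.TriangleEdge P x y z) :
    ∃ u v, OuterEdge P x y z u v ∧ (G.Adj u x ∨ G.Adj u y) := by
  by_contra! hne
  refine T.noStar ⟨x, y, z, z, T.adj_xy, T.adj_xz, T.adj_xz, fun u v huv => ?_⟩
  by_contra! h
  have ho : OuterEdge P x y z u v := ⟨huv, by tauto, by tauto⟩
  have := hne _ _ ho
  have := hne _ _ (T.outer_symm ho)
  have := T.attach ho
  tauto

/-- If the end `u` of an outer edge `uv` is attached to `x`, then `v` is attached to neither `y`
nor `z`, since `x` has a path of length two to each of them inside the triangle. -/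
theorem not_adj_other (T : G.TriangleEdge P x y z) (h : OuterEdge P x y z u v)
    (hux : G.Adj u x) : ¬ G.Adj v y ∧ ¬ G.Adj v z := by
  have e := T.rel.adj h.edge
  have l := h.left
  have r := h.right
  have d1 := T.adj_xy.ne
  have d2 := T.adj_xz.ne
  have d3 := T.adj_yz.ne
  constructor
  · intro h'
    have := T.free.five_cycle u x z y v hux T.adj_xz T.adj_yz.symm h'.symm e.symm
    grind
  · intro h'
    have := T.free.five_cycle u x y z v hux T.adj_xy T.adj_yz h'.symm e.symm
    grind

/-- An outer edge attached to both `x` and `y` by its end `u` would force every outer edge through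
`u`. -/
theorem not_adj_both (T : G.TriangleEdge P x y z) (h : OuterEdge P x y z u v)
    (hux : G.Adj u x) : ¬ G.Adj u y := by
  intro huy
  refine T.noStar ⟨x, y, z, u, T.adj_xy, T.adj_xz, hux.symm, ?_⟩
  have main : ∀ {a b}, OuterEdge P x y z a b → G.Adj a x ∨ G.Adj a y → a = u ∨ b = u := by
    rintro a b hab (ha | ha)
    · exact T.rel.eq_of_two_attachments T.free T.adj_xy T.adj_xz T.adj_yz h.edge hab.edge hux huy
        ha h.right h.left.2.2 hab.left.2 hab.right
    · exact T.rel.eq_of_two_attachments T.free T.adj_xy.symm T.adj_yz T.adj_xz h.edge hab.edge huy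
        hux ha (outer_swap h).right h.left.2.2 (outer_swap hab).left.2 (outer_swap hab).right
  intro a b hab
  by_contra! hne
  have ho : OuterEdge P x y z a b := ⟨hab, by tauto, by tauto⟩
  have := T.attach ho
  have := main ho
  have := main (T.outer_symm ho)
  tauto

/-- An edge `zp` of `P` leaving the triangle forces the outer edges attached to `x` to be attached
to `z` as well. -/
theorem adj_apex_of_apex_edge (T : G.TriangleEdge P x y z) (h : OuterEdge P x y z u v)
    (hux : G.Adj u x) (hzp : P z p) (hpx : p ≠ x) (hpy : p ≠ y) : G.Adj u z := by
  have e := T.rel.adj h.edge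
  have e' := T.rel.adj hzp
  have l := h.left
  have r := h.right
  have d1 := T.adj_xy.ne
  have d2 := T.adj_xz.ne
  have d3 := T.adj_yz.ne
  have n := (T.not_adj_other h hux).2
  rcases T.rel.conn h.edge hzp with c | c | c | c | c | c | c | c
  · exact absurd c l.2.2
  · exact c ▸ e'.symm
  · exact absurd c r.2.2
  · exact absurd (c ▸ e'.symm) n
  · exact c
  · have := T.free.five_cycle u p z y x c e'.symm T.adj_yz.symm T.adj_xy.symm hux.symm
    grind [G.loopless]
  · exact absurd c n
  · have := T.free.five_cycle u v p z x e c e'.symm T.adj_xz.symm hux.symm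
    grind [G.adj_comm]

theorem no_apex_edge_of_outer (T : G.TriangleEdge P x y z) (h : OuterEdge P x y z u v)
    (hux : G.Adj u x) (hzp : P z p) (hpx : p ≠ x) (hpy : p ≠ y) : False := by
  have huz := T.adj_apex_of_apex_edge h hux hzp hpx hpy
  refine T.noStar ⟨x, y, z, u, T.adj_xy, T.adj_xz, hux.symm, ?_⟩
  have main : ∀ {a b}, OuterEdge P x y z a b → G.Adj a x ∨ G.Adj a y → a = u ∨ b = u := by
    intro a b hab ha
    have haz : G.Adj a z := by
      rcases ha with ha | ha
      · exact T.adj_apex_of_apex_edge hab ha hzp hpx hpy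
      · exact T.swap.adj_apex_of_apex_edge (outer_swap hab) ha hzp hpy hpx
    exact T.rel.eq_of_two_attachments T.free T.adj_xz.symm T.adj_yz.symm T.adj_xy h.edge hab.edge
      huz hux haz ⟨h.right.2.2, h.right.1, h.right.2.1⟩ h.left.2.1 ⟨hab.left.1, hab.left.2.1⟩
      ⟨hab.right.2.2, hab.right.1, hab.right.2.1⟩
  intro a b hab
  by_contra! hne
  have ho : OuterEdge P x y z a b := ⟨hab, by tauto, by tauto⟩
  have := T.attach ho
  have := main ho
  have := main (T.outer_symm ho)
  tauto

/-- The third vertex `z` of the triangle is on no edge of `P` other than `xz` and `yz`: by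
`adj_apex_of_apex_edge` any other one would make all outer edges share a vertex. -/
theorem eq_of_apex_edge (T : G.TriangleEdge P x y z) (hzp : P z p) : p = x ∨ p = y := by
  by_contra! hne
  obtain ⟨u, v, ho, h | h⟩ := T.exists_outer
  · exact T.no_apex_edge_of_outer ho h hzp hne.1 hne.2
  · exact T.swap.no_apex_edge_of_outer (outer_swap ho) h hzp hne.2 hne.1

/-- An outer edge attached to `x` and one attached to `y` are disjoint and joined by their far ends. -/
theorem opposite (T : G.TriangleEdge P x y z) (h : OuterEdge P x y z u v)
    (h' : OuterEdge P x y z u' v') (hux : G.Adj u x) (huy' : G.Adj u' y) :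
    G.Adj v v' ∧ u ≠ v' ∧ v ≠ u' ∧ v ≠ v' ∧ u ≠ u' := by
  have e := T.rel.adj h.edge
  have e' := T.rel.adj h'.edge
  have l := h.left
  have r := h.right
  have l' := h'.left
  have r' := h'.right
  have d1 := T.adj_xy.ne
  have d2 := T.adj_xz.ne
  have d3 := T.adj_yz.ne
  have k1 : u ≠ u' := fun c => T.not_adj_both h hux (c ▸ huy')
  have n1 : ¬ G.Adj u u' := fun c => by
    have := T.free.five_cycle u u' y z x c huy' T.adj_yz T.adj_xz.symm hux.symm
    grind
  have k2 : u ≠ v' := fun c => n1 (c ▸ e'.symm)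
  have k3 : v ≠ u' := fun c => n1 (c ▸ e)
  have k4 : v ≠ v' := fun c => by
    have := T.free.five_cycle u v u' y x e (c ▸ e'.symm) huy' T.adj_xy.symm hux.symm
    grind
  refine ⟨?_, k2, k3, k4, k1⟩
  rcases T.rel.conn h.edge h'.edge with c | c | c | c | c | c | c | c
  · exact absurd c k1
  · exact absurd c k2
  · exact absurd c k3
  · exact absurd c k4
  · exact absurd c n1
  · have := T.free.five_cycle u v' u' y x c e'.symm huy' T.adj_xy.symm hux.symm
    grind
  · have := T.free.five_cycle u v u' y x e c huy' T.adj_xy.symm hux.symm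
    grind
  · exact c

/-- No outer edge `uv` forms a triangle with `x`. Otherwise all edges of `P` disjoint from `uvx` are
attached to `x` and to one of `u`, `v`, hence share a vertex, and `P` has a star cover centred
at `x`. -/
theorem not_adj_same (T : G.TriangleEdge P x y z) (h : OuterEdge P x y z u v)
    (hux : G.Adj u x) : ¬ G.Adj v x := by
  intro hvx
  have e := T.rel.adj h.edge
  have l := h.left
  have r := h.right
  have d1 := T.adj_xy.ne
  have d2 := T.adj_xz.ne
  have d3 := T.adj_yz.ne
  have hvu := T.outer_symm h
  have nu := T.not_adj_other hvu hvx
  have nv := T.not_adj_other h hux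
  -- An edge of `P` disjoint from the triangle `uvx` is attached to `x` and to one of `u`, `v`.
  have main : ∀ {a b}, P a b → a ≠ u → a ≠ v → a ≠ x → b ≠ u → b ≠ v → b ≠ x →
      OuterEdge P x y z a b ∧ ((G.Adj a x ∧ (G.Adj a u ∨ G.Adj a v)) ∨
        (G.Adj b x ∧ (G.Adj b u ∨ G.Adj b v))) := by
    intro a b hab au av ax bu bv bx
    have notY : ∀ {a b}, P a b → a ≠ u → a ≠ v → a ≠ x → b ≠ u → b ≠ v → b ≠ x → b ≠ y := by
      rintro a b hab au av ax bu bv bx rfl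
      have e' := T.rel.adj hab
      have m1 : ∀ {w}, G.Adj w x → G.Adj a w → w ≠ b → w ≠ z → w ≠ a → ¬ G.Adj w z → False := by
        intro w wx aw wb wz wa nwz
        have := T.free.five_cycle a w x z b aw wx T.adj_xz T.adj_yz.symm e'.symm
        grind [G.adj_comm]
      rcases T.rel.conn h.edge hab with c | c | c | c | c | c | c | c
      · exact au c.symm
      · exact bu c.symm
      · exact av c.symm
      · exact bv c.symm
      · exact m1 hux c.symm l.2.1 l.2.2 au.symm nu.2
      · exact nu.1 c
      · exact m1 hvx c.symm r.2.1 r.2.2 av.symm nv.2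
      · exact nv.1 c
    have by' := notY hab au av ax bu bv bx
    have ay' := notY (T.rel.symm hab) bu bv bx au av ax
    have bz : b ≠ z := fun c => by
      rcases T.eq_of_apex_edge (c ▸ T.rel.symm hab) with c | c
      · exact ax c
      · exact ay' c
    have az : a ≠ z := fun c => by
      rcases T.eq_of_apex_edge (c ▸ hab) with c | c
      · exact bx c
      · exact by' c
    have ho : OuterEdge P x y z a b := ⟨hab, ⟨ax, ay', az⟩, ⟨bx, by', bz⟩⟩
    refine ⟨ho, ?_⟩
    have noY : ∀ {a b}, OuterEdge P x y z a b → ¬ G.Adj a y := by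
      intro a b ho ha
      have o1 := T.opposite h ho hux ha
      have o2 := T.opposite hvu ho hvx ha
      have := T.free.five_cycle u b a y x o2.1 (T.rel.adj ho.edge).symm ha T.adj_xy.symm hux.symm
      have := ho.left
      have := ho.right
      grind
    have toX : ∀ {a b}, OuterEdge P x y z a b → a ≠ u → a ≠ v → b ≠ u → b ≠ v → G.Adj a x →
        G.Adj a u ∨ G.Adj a v := by
      intro a b ho au av bu bv hax
      have e' := T.rel.adj ho.edge
      have := ho.left
      have := ho.right
      rcases T.rel.conn h.edge ho.edge with c | c | c | c | c | c | c | c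
      · exact absurd c.symm au
      · exact absurd c.symm bu
      · exact absurd c.symm av
      · exact absurd c.symm bv
      · exact Or.inl c.symm
      · have := T.free.five_cycle u b a x v c e'.symm hax hvx.symm e.symm
        grind
      · exact Or.inr c.symm
      · have := T.free.five_cycle v b a x u c e'.symm hax hux.symm e
        grind
    rcases T.attach ho with c | c | c | c
    · exact Or.inl ⟨c, toX ho au av bu bv c⟩
    · exact absurd c (noY ho)
    · exact Or.inr ⟨c, toX (T.outer_symm ho) bu bv au av c⟩
    · exact absurd c (noY (T.outer_symm ho))
  have step : ∀ {a b u v}, OuterEdge P x y z u v → OuterEdge P x y z a b → G.Adj u x →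
      G.Adj v x → G.Adj a x → G.Adj a u → a ≠ u → a ≠ v → b ≠ u → b ≠ v → ∀ c d, P c d → c ≠ u →
      c ≠ v → c ≠ x → d ≠ u → d ≠ v → d ≠ x → G.Adj c x → c = a ∨ d = a := by
    intro a b u v h ho hux hvx hax hau au av bu bv c d hcd cu cv cx du dv dx hc
    exact T.rel.eq_of_two_attachments T.free hux.symm hvx.symm (T.rel.adj h.edge) ho.edge hcd hax
      hau hc ⟨ho.right.1, bu, bv⟩ av ⟨cu, cv⟩ ⟨dx, du, dv⟩
  by_cases hex : ∃ a b, OuterEdge P x y z a b ∧ a ≠ u ∧ a ≠ v ∧ b ≠ u ∧ b ≠ v ∧ G.Adj a x ∧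
      (G.Adj a u ∨ G.Adj a v)
  · obtain ⟨a, b, ho, au, av, bu, bv, hax, hauv⟩ := hex
    have fin : ∀ c d, P c d → c ≠ u → c ≠ v → c ≠ x → d ≠ u → d ≠ v → d ≠ x → G.Adj c x →
        c = a ∨ d = a := by
      intro c d hcd cu cv cx du dv dx hc
      rcases hauv with hau | hav
      · exact step h ho hux hvx hax hau au av bu bv c d hcd cu cv cx du dv dx hc
      · exact step hvu ho hvx hux hax hav av au bv bu c d hcd cv cu cx dv du dx hc
    refine T.noStar ⟨x, u, v, a, hux.symm, hvx.symm, hax.symm, fun c d hcd => ?_⟩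
    by_contra! hne
    obtain ⟨n1, n2, n3, n4, n5, n6, n7, n8⟩ := hne
    rcases (main hcd n2 n3 n1 n6 n7 n5).2 with w | w
    · have := fin c d hcd n2 n3 n1 n6 n7 n5 w.1
      tauto
    · have := fin d c (T.rel.symm hcd) n6 n7 n5 n2 n3 n1 w.1
      tauto
  · refine T.noStar ⟨x, u, v, v, hux.symm, hvx.symm, hvx.symm, fun c d hcd => ?_⟩
    by_contra! hne
    obtain ⟨n1, n2, n3, n4, n5, n6, n7, n8⟩ := hne
    obtain ⟨ho, w | w⟩ := main hcd n2 n3 n1 n6 n7 n5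
    · exact hex ⟨c, d, ho, n2, n3, n6, n7, w⟩
    · exact hex ⟨d, c, T.outer_symm ho, n6, n7, n2, n3, w⟩

/-- The strong clique does not contain the whole triangle: an outer edge attached to `x` only is not
joined to `yz`. -/
theorem not_all_edges (T : G.TriangleEdge P x y z) (hxz : P x z) : ¬ P y z := by
  intro hyz
  have T₁ : G.TriangleEdge P x z y :=
    ⟨T.rel, T.free, hxz, T.adj_xy, T.adj_yz.symm, T.noStar⟩
  have T₂ : G.TriangleEdge P y z x :=
    ⟨T.rel, T.free, hyz, T.adj_xy.symm, T.adj_xz.symm, T.noStar⟩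
  have key : ∀ {x y z}, G.TriangleEdge P x y z → G.TriangleEdge P x z y → P y z →
      ∀ u v, OuterEdge P x y z u v → ¬ G.Adj u x := by
    intro x y z T T₁ hyz u v h hux
    have l := h.left
    have r := h.right
    have n := T.not_adj_other h hux
    have n2 := T.not_adj_both h hux
    have n3 := T₁.not_adj_both ⟨h.edge, ⟨l.1, l.2.2, l.2.1⟩, ⟨r.1, r.2.2, r.2.1⟩⟩ hux
    have := T.rel.conn h.edge hyz
    tauto
  obtain ⟨u, v, ho, h | h⟩ := T.exists_outer
  · exact key T T₁ hyz u v ho h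
  · exact key T.swap T₂ hxz u v (outer_swap ho) h

/-- An edge of `P` at `y` other than `xy` is joined to an outer edge attached to `x` in the direction
that the bipartition allows. -/
theorem adj_of_edge_at (T : G.TriangleEdge P x y z) (h : OuterEdge P x y z u v)
    (hux : G.Adj u x) (hqy : P q y) (hqx : q ≠ x) : G.Adj q u := by
  have e := T.rel.adj h.edge
  have e' := T.rel.adj hqy
  have l := h.left
  have r := h.right
  have d1 := T.adj_xy.ne
  have n := T.not_adj_other h hux
  have n2 := T.not_adj_both h hux
  rcases T.rel.conn h.edge hqy with c | c | c | c | c | c | c | c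
  · exact absurd (c ▸ e') n2
  · exact absurd c l.2.1
  · exact absurd (c ▸ e') n.1
  · exact absurd c r.2.1
  · exact c.symm
  · exact absurd c n2
  · have := T.free.five_cycle u v q y x e c e' T.adj_xy.symm hux.symm
    grind
  · exact absurd c n.1

/-- Two outer edges attached to `x` are joined by an edge of the direction that the bipartition
allows. Otherwise they are joined by an edge `uu'`, and all edges of `P` disjoint
from `x, u, u'` are attached to the whole triangle `xuu'`, so that they share a vertex. -/
theorem cross_of_same_side (T : G.TriangleEdge P x y z) (h : OuterEdge P x y z u v)
    (h' : OuterEdge P x y z u' v') (hux : G.Adj u x) (hux' : G.Adj u' x) :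
    G.Adj v u' ∨ G.Adj v' u := by
  by_contra! hn
  have e := T.rel.adj h.edge
  have e' := T.rel.adj h'.edge
  have l := h.left
  have r := h.right
  have l' := h'.left
  have r' := h'.right
  have d1 := T.adj_xy.ne
  have d2 := T.adj_xz.ne
  have d3 := T.adj_yz.ne
  have nv := T.not_adj_same h hux
  have nv' := T.not_adj_same h' hux'
  have k1 : u ≠ u' := fun c => hn.1 (c ▸ e.symm)
  have k2 : v ≠ v' := fun c => hn.2 (c ▸ e.symm)
  have k3 : u ≠ v' := fun c => nv' (c ▸ hux)
  have k4 : v ≠ u' := fun c => nv (c ▸ hux')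
  have huu : G.Adj u u' := by
    rcases T.rel.conn h.edge h'.edge with c | c | c | c | c | c | c | c
    · exact absurd c k1
    · exact absurd c k3
    · exact absurd c k4
    · exact absurd c k2
    · exact c
    · exact absurd c.symm hn.2
    · exact absurd c hn.1
    · have := T.free.five_cycle u v v' u' x e c e'.symm hux' hux.symm
      grind
  have noY : ∀ {a b}, OuterEdge P x y z a b → ¬ G.Adj a y := by
    intro a b ho ha
    have o1 := T.opposite h ho hux ha
    have o2 := T.opposite h' ho hux' ha
    have := T.free.five_cycle u u' v' b v huu e' o2.1 o1.1.symm e.symm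
    grind
  have noQ : ∀ {q}, P q y → q = x := by
    intro q hq
    by_contra hqx
    have f := T.adj_of_edge_at h hux hq hqx
    have f' := T.adj_of_edge_at h' hux' hq hqx
    have := T.free.five_cycle y q u u' x (T.rel.adj hq).symm f huu hux' T.adj_xy
    have n2 := T.not_adj_both h hux
    have n2' := T.not_adj_both h' hux'
    have := f.ne
    have := f'.ne
    grind
  have main : ∀ {a b}, P a b → a ≠ x → b ≠ x →
      OuterEdge P x y z a b ∧ (G.Adj a x ∨ G.Adj b x) := by
    intro a b hab ax bx
    have ay : a ≠ y := fun c => bx (noQ (c ▸ T.rel.symm hab))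
    have by' : b ≠ y := fun c => ax (noQ (c ▸ hab))
    have az : a ≠ z := fun c => (T.eq_of_apex_edge (c ▸ hab)).elim bx by'
    have bz : b ≠ z := fun c => (T.eq_of_apex_edge (c ▸ T.rel.symm hab)).elim ax ay
    have ho : OuterEdge P x y z a b := ⟨hab, ⟨ax, ay, az⟩, ⟨bx, by', bz⟩⟩
    refine ⟨ho, ?_⟩
    have := T.attach ho
    have := noY ho
    have := noY (T.outer_symm ho)
    tauto
  -- Every further outer edge is attached to all three vertices of the triangle `xuu'`.
  have attachU : ∀ {u v u' v' a b}, OuterEdge P x y z u v → OuterEdge P x y z u' v' →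
      G.Adj u x → G.Adj u' x → G.Adj u u' → u ≠ u' → v ≠ v' → v ≠ u' → u ≠ v' →
      OuterEdge P x y z a b → G.Adj a x → a ≠ u →
      a ≠ u' → b ≠ u → b ≠ u' → G.Adj a u := by
    intro u v u' v' a b h h' hux hux' huu k1 k2 k3 k4 ho hax au au' bu bu'
    have e := T.rel.adj h.edge
    have e'' := T.rel.adj ho.edge
    have l := h.left
    have r := h.right
    have l' := h'.left
    have l'' := ho.left
    have r'' := ho.right
    have nv := T.not_adj_same h hux
    have nb := T.not_adj_same ho hax
    have m1 : ¬ G.Adj a v := fun c => by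
      have := T.free.five_cycle a v u u' x c e.symm huu hux' hax.symm
      grind
    rcases T.rel.conn h.edge ho.edge with c | c | c | c | c | c | c | c
    · exact absurd c.symm au
    · exact absurd c.symm bu
    · exact absurd (c ▸ hax) nv
    · exact absurd (c ▸ e'') m1
    · exact c.symm
    · have := T.free.five_cycle b u u' x a c.symm huu hux' hax.symm e''
      grind
    · exact absurd c.symm m1
    · have := T.free.five_cycle u v b a x e c e''.symm hax hux.symm
      grind
  by_cases hex : ∃ a b, OuterEdge P x y z a b ∧ G.Adj a x ∧ a ≠ u ∧ a ≠ u' ∧ b ≠ u ∧ b ≠ u'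
  · obtain ⟨a, b, ho, hax, au, au', bu, bu'⟩ := hex
    have f1 := attachU h h' hux hux' huu k1 k2 k4 k3 ho hax au au' bu bu'
    have f2 := attachU h' h hux' hux huu.symm k1.symm k2.symm k3.symm k4.symm ho hax au' au bu' bu
    have fin : ∀ {c d}, OuterEdge P x y z c d → G.Adj c x → c ≠ u → c ≠ u' → c ≠ a → d ≠ u →
        d ≠ u' → False := by
      intro c d hc hcx cu cu' ca du du'
      have f3 := attachU h' h hux' hux huu.symm k1.symm k2.symm k3.symm k4.symm hc hcx cu' cu du' du
      have := T.free.five_cycle x u a u' c hux.symm f1.symm f2 f3.symm hcx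
      have := hc.left
      have := ho.left
      grind
    refine T.noStar ⟨x, u, u', a, hux.symm, hux'.symm, hax.symm, fun c d hcd => ?_⟩
    by_contra! hne
    obtain ⟨n1, n2, n3, n4, n5, n6, n7, n8⟩ := hne
    obtain ⟨hc, w | w⟩ := main hcd n1 n5
    · exact fin hc w n2 n3 n4 n6 n7
    · exact fin (T.outer_symm hc) w n6 n7 n8 n2 n3
  · refine T.noStar ⟨x, u, u', u', hux.symm, hux'.symm, hux'.symm, fun c d hcd => ?_⟩
    by_contra! hne
    obtain ⟨n1, n2, n3, n4, n5, n6, n7, n8⟩ := hne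
    obtain ⟨hc, w | w⟩ := main hcd n1 n5
    · exact hex ⟨c, d, hc, w, n2, n3, n6, n7⟩
    · exact hex ⟨d, c, T.outer_symm hc, w, n6, n7, n2, n3⟩

/-- The bipartition of a strong clique with an edge `xy` in a triangle: edges leave `x`, enter `y`,
and outer edges are directed into `N(x)` or out of `N(y)`. -/
def Dir (G : SimpleGraph V) (P : V → V → Prop) (x y z a b : V) : Prop :=
  P a b ∧ (a = x ∨ b = y ∨ (OuterEdge P x y z a b ∧ (G.Adj b x ∨ G.Adj a y)))

theorem dir_reverse (T : G.TriangleEdge P x y z) {a b : V} (h : Dir G P x y z a b) :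
    Dir G P y x z b a := by
  obtain ⟨h, h' | h' | ⟨h', h'' | h''⟩⟩ := h
  · exact ⟨T.rel.symm h, Or.inr (Or.inl h')⟩
  · exact ⟨T.rel.symm h, Or.inl h'⟩
  · exact ⟨T.rel.symm h, Or.inr (Or.inr ⟨outer_swap (T.outer_symm h'), Or.inr h''⟩)⟩
  · exact ⟨T.rel.symm h, Or.inr (Or.inr ⟨outer_swap (T.outer_symm h'), Or.inl h''⟩)⟩

theorem dir_total (T : G.TriangleEdge P x y z) {a b : V} (h : P a b) :
    Dir G P x y z a b ∨ Dir G P x y z b a := by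
  by_cases h1 : a = x
  · exact Or.inl ⟨h, Or.inl h1⟩
  by_cases h2 : b = y
  · exact Or.inl ⟨h, Or.inr (Or.inl h2)⟩
  by_cases h3 : b = x
  · exact Or.inr ⟨T.rel.symm h, Or.inl h3⟩
  by_cases h4 : a = y
  · exact Or.inr ⟨T.rel.symm h, Or.inr (Or.inl h4)⟩
  have h5 : a ≠ z := fun c => by
    have := T.eq_of_apex_edge (c ▸ h)
    tauto
  have h6 : b ≠ z := fun c => by
    have := T.eq_of_apex_edge (c ▸ T.rel.symm h)
    tauto
  have ho : OuterEdge P x y z a b := ⟨h, ⟨h1, h4, h5⟩, ⟨h3, h2, h6⟩⟩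
  rcases T.attach ho with c | c | c | c
  · exact Or.inr ⟨T.rel.symm h, Or.inr (Or.inr ⟨T.outer_symm ho, Or.inl c⟩)⟩
  · exact Or.inl ⟨h, Or.inr (Or.inr ⟨ho, Or.inr c⟩)⟩
  · exact Or.inl ⟨h, Or.inr (Or.inr ⟨ho, Or.inl c⟩)⟩
  · exact Or.inr ⟨T.rel.symm h, Or.inr (Or.inr ⟨T.outer_symm ho, Or.inr c⟩)⟩

/-- No common neighbour `w` of `x` and `y` is joined to both by edges of `P`; otherwise `w` would
be both a head and a tail. -/
theorem not_both_edges (T : G.TriangleEdge P x y z) {w : V} (h : P x w) : ¬ P w y := fun h' =>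
  (TriangleEdge.mk T.rel T.free T.edge (T.rel.adj h) (T.rel.adj h').symm T.noStar).not_all_edges h
    (T.rel.symm h')

/-- Compatibility of two edges, the first of which leaves `x` or is an outer edge into `N(x)`. -/
theorem dir_compat_left (T : G.TriangleEdge P x y z) {a b a' b' : V}
    (h : P a b ∧ (a = x ∨ (OuterEdge P x y z a b ∧ G.Adj b x))) (h' : Dir G P x y z a' b') :
    a ≠ b' ∧ a' ≠ b ∧ (G.Adj a b' ∨ G.Adj a' b) := by
  obtain ⟨hab, h⟩ := h
  obtain ⟨hab', h'⟩ := h'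
  have e := T.rel.adj hab
  have e' := T.rel.adj hab'
  have exy := T.adj_xy
  rcases h with rfl | ⟨ho, hb⟩
  · rcases h' with rfl | rfl | ⟨ho', hb' | ha'⟩
    · exact ⟨e'.ne, e.ne, Or.inl e'⟩
    · exact ⟨exy.ne, fun c => T.not_both_edges hab (c ▸ hab'), Or.inl exy⟩
    · exact ⟨ho'.right.1.symm, fun c => T.not_adj_same (T.outer_symm ho') hb' (c ▸ e.symm),
        Or.inl hb'.symm⟩
    · refine ⟨ho'.right.1.symm, fun c => T.not_adj_both ho' (c ▸ e.symm) ha', Or.inr ?_⟩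
      by_cases hby : b = y
      · exact hby ▸ ha'
      · exact (T.swap.adj_of_edge_at (outer_swap ho') ha' (T.rel.symm hab) hby).symm
  · have ho2 := T.outer_symm ho
    have n := T.not_adj_same ho2 hb
    rcases h' with rfl | rfl | ⟨ho', hb' | ha'⟩
    · exact ⟨fun c => n (c ▸ e'.symm), ho.right.1.symm, Or.inr hb.symm⟩
    · refine ⟨ho.left.2.1, fun c => T.not_adj_both ho2 hb (c ▸ e'), ?_⟩
      by_cases ha'x : a' = x
      · exact Or.inr (ha'x ▸ hb.symm)
      · exact Or.inr (T.adj_of_edge_at ho2 hb hab' ha'x)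
    · have n' := T.not_adj_same (T.outer_symm ho') hb'
      exact ⟨fun c => n (c ▸ hb'), fun c => n' (c ▸ hb),
        T.cross_of_same_side ho2 (T.outer_symm ho') hb hb'⟩
    · have := T.opposite ho2 ho' hb ha'
      exact ⟨this.2.2.2.1, this.2.2.2.2.symm, Or.inl this.1⟩

theorem hasBipartition (T : G.TriangleEdge P x y z) : G.HasBipartition P := by
  refine ⟨Dir G P x y z, fun a b h => h.1, fun a b h => T.dir_total h, ?_⟩
  have split : ∀ {x y a b}, Dir G P x y z a b →
      (P a b ∧ (a = x ∨ (OuterEdge P x y z a b ∧ G.Adj b x))) ∨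
      b = y ∨ (OuterEdge P x y z a b ∧ G.Adj a y) := by
    rintro x y a b ⟨h, h'⟩
    tauto
  intro a b a' b' h h'
  rcases split h with c | c
  · have := T.dir_compat_left c h'
    exact ⟨this.1, this.2.2⟩
  · have hrev : P b a ∧ (b = y ∨ (OuterEdge P y x z b a ∧ G.Adj a y)) :=
      ⟨T.rel.symm h.1, c.imp id fun c => ⟨outer_swap (T.outer_symm c.1), c.2⟩⟩
    have := T.swap.dir_compat_left hrev (T.dir_reverse h')
    exact ⟨this.2.1.symm, this.2.2.symm.imp G.adj_symm G.adj_symm⟩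

end TriangleEdge

/-- A strong clique of a `C_5`-free graph has a bipartition, unless it is covered by a star with at
most three leaves; the latter is only needed in the presence of triangles. -/
theorem IsStrongCliqueRel.hasBipartition_or_starCover (hP : G.IsStrongCliqueRel P)
    (h5 : (cycleGraph 5).Free G) :
    G.HasBipartition P ∨ (G.StarCover P ∧ ∃ a b c, G.Adj a b ∧ G.Adj b c ∧ G.Adj c a) := by
  by_cases hT : ∃ x y z, P x y ∧ G.Adj x z ∧ G.Adj y z
  · obtain ⟨x, y, z, hxy, hxz, hyz⟩ := hT
    by_cases hS : G.StarCover P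
    · exact Or.inr ⟨hS, _, _, _, hP.adj hxy, hyz, hxz.symm⟩
    · exact Or.inl (TriangleEdge.mk hP h5 hxy hxz hyz hS).hasBipartition
  · refine hP.hasBipartition_of_no_triangle_edge h5 fun x y z h1 h2 h3 => hT ⟨x, y, z, h1, h2, h3⟩

end Reduction

/-! ### Paths and cycles in semicomplete digraphs -/

section Semicomplete

variable {ι : Type*} {R : ι → ι → Prop}

theorem exists_chain_insert {a v : ι} (l : List ι) (hv : ∀ b ∈ l, R v b ∨ R b v)
    (hl : (a :: l).IsChain R) (hav : R a v) :
    ∃ l' : List ι, l'.Perm (v :: l) ∧ (a :: l').IsChain R := by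
  induction l generalizing a with
  | nil => exact ⟨[v], List.Perm.refl _, by simpa using hav⟩
  | cons b l ih =>
    rw [List.isChain_cons_cons] at hl
    by_cases hvb : R v b
    · exact ⟨v :: b :: l, List.Perm.refl _, by simp [List.isChain_cons_cons, hav, hvb, hl.2]⟩
    · have hbv := (hv b (by simp)).resolve_left hvb
      obtain ⟨l', hp, hc⟩ := ih (fun c hc => hv c (by simp [hc])) hl.2 hbv
      exact ⟨b :: l', (hp.cons b).trans (List.Perm.swap v b l), by
        simp [List.isChain_cons_cons, hl.1, hc]⟩

/-- Rédei's theorem: a semicomplete digraph has a Hamilton path. -/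
theorem exists_hamilton_list (s : Finset ι) (hR : ∀ a ∈ s, ∀ b ∈ s, R a b ∨ R b a) :
    ∃ l : List ι, l.Nodup ∧ (∀ a, a ∈ l ↔ a ∈ s) ∧ l.IsChain R := by
  classical
  induction s using Finset.induction_on with
  | empty => exact ⟨[], by simp⟩
  | insert v s hv ih =>
    obtain ⟨l, hnd, hmem, hc⟩ :=
      ih fun a ha b hb => hR a (Finset.mem_insert_of_mem ha) b (Finset.mem_insert_of_mem hb)
    have hvR : ∀ b ∈ l, R v b ∨ R b v := fun b hb =>
      hR v (Finset.mem_insert_self _ _) b (Finset.mem_insert_of_mem ((hmem b).1 hb))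
    suffices h : ∃ l' : List ι, l'.Perm (v :: l) ∧ l'.IsChain R by
      obtain ⟨l', hp, hc'⟩ := h
      refine ⟨l', hp.nodup_iff.2 (List.nodup_cons.2 ⟨fun h => hv ((hmem v).1 h), hnd⟩),
        fun a => ?_, hc'⟩
      rw [hp.mem_iff, List.mem_cons, hmem, Finset.mem_insert]
    cases l with
    | nil => exact ⟨[v], List.Perm.refl _, by simp⟩
    | cons b l =>
      by_cases hvb : R v b
      · exact ⟨v :: b :: l, List.Perm.refl _, by simp [List.isChain_cons_cons, hvb, hc]⟩
      · have hbv := (hvR b (by simp)).resolve_left hvb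
        obtain ⟨l', hp, hc'⟩ := exists_chain_insert l (fun c h => hvR c (by simp [h])) hc hbv
        exact ⟨b :: l', (hp.cons b).trans (List.Perm.swap v b l), hc'⟩

/-- The first `n` terms of the sequence `x` are distinct elements of `s`, each related to the
next. -/
structure IsPathSeq (R : ι → ι → Prop) (s : Finset ι) (n : ℕ) (x : ℕ → ι) : Prop where
  mem : ∀ i < n, x i ∈ s
  inj : ∀ i < n, ∀ j < n, x i = x j → i = j
  step : ∀ i, i + 1 < n → R (x i) (x (i + 1))

theorem exists_hamilton_path {s : Finset ι} (hs : s.Nonempty)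
    (hR : ∀ a ∈ s, ∀ b ∈ s, R a b ∨ R b a) : ∃ x, IsPathSeq R s s.card x := by
  classical
  obtain ⟨l, hnd, hmem, hc⟩ := exists_hamilton_list s hR
  obtain ⟨a₀, -⟩ := hs
  have hlen : l.length = s.card := by
    rw [← List.toFinset_card_of_nodup hnd]
    congr 1
    ext a
    simp [hmem]
  have hget : ∀ i (hi : i < s.card), l.getD i a₀ = l[i]'(hlen ▸ hi) := fun i hi =>
    List.getD_eq_getElem _ _ _
  refine ⟨fun i => l.getD i a₀, fun i hi => ?_, fun i hi j hj hij => ?_, fun i hi => ?_⟩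
  · rw [hget i hi, ← hmem]
    exact List.getElem_mem _
  · simp only [hget i hi, hget j hj] at hij
    exact (List.Nodup.getElem_inj_iff hnd).1 hij
  · simp only [hget i (by omega), hget (i + 1) hi]
    exact List.isChain_iff_getElem.1 hc i (by omega)

theorem IsPathSeq.reindex {s : Finset ι} {n m : ℕ} {x : ℕ → ι} (hx : IsPathSeq R s n x)
    (σ : ℕ → ℕ) (hσ : ∀ i < m, σ i < n) (hinj : ∀ i < m, ∀ j < m, σ i = σ j → i = j)
    (hstep : ∀ i, i + 1 < m → R (x (σ i)) (x (σ (i + 1)))) :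
    IsPathSeq R s m (fun i => x (σ i)) :=
  ⟨fun i hi => hx.mem _ (hσ i hi),
    fun i hi j hj hij => hinj i hi j hj (hx.inj _ (hσ i hi) _ (hσ j hj) hij), hstep⟩

/-- A semicomplete digraph on `k + 1 ≥ 4` vertices has a cycle of length `k`, or a Hamilton path
whose first vertex also dominates its last one. -/
theorem exists_cycle_or_shortcut_path {s : Finset ι} {k : ℕ} (hk : 3 ≤ k) (hs : s.card = k + 1)
    (hR : ∀ a ∈ s, ∀ b ∈ s, R a b ∨ R b a) :
    (∃ x, IsPathSeq R s k x ∧ R (x (k - 1)) (x 0)) ∨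
      ∃ x, IsPathSeq R s (k + 1) x ∧ R (x 0) (x k) := by
  obtain ⟨c, hc⟩ := exists_hamilton_path (Finset.card_pos.1 (by omega)) hR
  rw [hs] at hc
  refine or_iff_not_imp_left.2 fun hno => ?_
  push Not at hno
  by_cases h0k : R (c 0) (c k)
  · exact ⟨c, hc, h0k⟩
  have total : ∀ i j, i ≤ k → j ≤ k → ¬ R (c i) (c j) → R (c j) (c i) := fun i j hi hj h =>
    (hR _ (hc.mem i (by omega)) _ (hc.mem j (by omega))).resolve_left h
  have hk0 := total 0 k (by omega) le_rfl h0k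
  -- Since `c` closes up to a Hamilton cycle, omitting `c 0`, `c 1` or `c k` would leave a `k`-cycle.
  have s0 : ¬ R (c k) (c 1) := fun h => by
    refine hno _ (hc.reindex (m := k) (fun i => i + 1) (fun i hi => by omega)
      (fun i _ j _ h => by omega) fun i hi => hc.step _ (by omega)) ?_
    have : k - 1 + 1 = k := by omega
    simpa [this] using h
  have s1 : ¬ R (c 0) (c 2) := fun h => by
    refine hno _ (hc.reindex (m := k) (fun i => if i = 0 then 0 else i + 1)
      (fun i hi => by split_ifs <;> omega)
      (fun i _ j _ h => by split_ifs at h <;> omega) fun i hi => ?_) ?_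
    · by_cases hi0 : i = 0
      · simpa [hi0] using h
      · simpa [hi0] using hc.step (i + 1) (by omega)
    · have h1 : k - 1 ≠ 0 := by omega
      have : k - 1 + 1 = k := by omega
      simpa [h1, this] using hk0
  have sk : ¬ R (c (k - 1)) (c 0) := fun h =>
    hno c ⟨fun i hi => hc.mem i (by omega), fun i hi j hj => hc.inj i (by omega) j (by omega),
      fun i hi => hc.step i (by omega)⟩ h
  have r20 := total 0 2 (by omega) (by omega) s1
  -- Hence `c 0` can be inserted into the path `c 1, …, c k`, away from its ends.
  obtain ⟨i, hi2, hik, hi0, h0i⟩ : ∃ i, 2 ≤ i ∧ i + 1 < k ∧ R (c i) (c 0) ∧ R (c 0) (c (i + 1)) := by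
    by_contra! hcon
    have all : ∀ j, 2 ≤ j → j < k → R (c j) (c 0) := by
      intro j hj
      induction j, hj using Nat.le_induction with
      | base => exact fun _ => r20
      | succ j hj ih =>
        intro hjk
        have := hcon j hj hjk (ih (by omega))
        exact total 0 (j + 1) (by omega) (by omega) this
    exact sk (all (k - 1) (by omega) (by omega))
  refine ⟨_, hc.reindex (m := k + 1) (fun j => if j < i then j + 1 else if j = i then 0 else j)
    (fun j hj => by split_ifs <;> omega) (fun j _ l _ h => by split_ifs at h <;> omega)
    (fun j hj => ?_), ?_⟩
  · rcases lt_trichotomy j i with h | h | h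
    · rcases Nat.lt_or_ge (j + 1) i with h' | h'
      · simpa [h, h'] using hc.step (j + 1) (by omega)
      · have : j + 1 = i := by omega
        simpa [h, this] using hi0
    · simpa [h] using h0i
    · have h1 : ¬ j < i := by omega
      have h2 : j ≠ i := by omega
      have h3 : ¬ j + 1 < i := by omega
      have h4 : j + 1 ≠ i := by omega
      simpa [h1, h2, h3, h4] using hc.step j (by omega)
  · have h0 : 0 < i := by omega
    have h1 : ¬ k < i := by omega
    have h2 : k ≠ i := by omega
    simpa [h0, h1, h2] using total k 1 le_rfl (by omega) s0

/-- A semicomplete digraph on `k` vertices without Hamilton cycle misses at least `k - 1` ordered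
pairs. -/
theorem card_not_rel_of_no_hamilton_cycle [DecidableEq ι] [DecidableRel R] {s : Finset ι} {k : ℕ}
    (hk : 2 ≤ k) (hs : s.card = k) (hR : ∀ a ∈ s, ∀ b ∈ s, R a b ∨ R b a)
    (hno : ∀ x, IsPathSeq R s k x → ¬ R (x (k - 1)) (x 0)) :
    k - 1 ≤ ((s ×ˢ s).filter fun p => ¬ R p.1 p.2).card := by
  obtain ⟨c, hc⟩ := exists_hamilton_path (Finset.card_pos.1 (by omega)) hR
  rw [hs] at hc
  have hclose := hno c hc
  -- If the three pairs at `i` were all present, `c i` could be moved to the front of the path.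
  have miss : ∀ i, 0 < i → i + 1 < k → ¬ R (c (k - 1)) (c i) ∨ ¬ R (c i) (c 0) ∨
      ¬ R (c (i - 1)) (c (i + 1)) := by
    intro i hi hik
    by_contra! hall
    obtain ⟨h1, h2, h3⟩ := hall
    refine hno _ (hc.reindex (m := k) (fun j => if j = 0 then i else if j ≤ i then j - 1 else j)
      (fun j hj => by split_ifs <;> omega) (fun j _ l _ h => by split_ifs at h <;> omega)
      (fun j hj => ?_)) ?_
    · by_cases hj0 : j = 0
      · have h : 0 + 1 ≤ i := hi
        simpa [hj0, h] using h2
      · rcases lt_trichotomy j i with h | h | h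
        · have e1 : j ≤ i := by omega
          have e2 : j + 1 ≤ i := by omega
          have := hc.step (j - 1) (by omega)
          rw [Nat.sub_add_cancel (by omega)] at this
          simpa [hj0, e1, e2] using this
        · subst h
          simpa [hj0] using h3
        · have e1 : ¬ j ≤ i := by omega
          have e2 : ¬ j + 1 ≤ i := by omega
          simpa [hj0, e1, e2] using hc.step j (by omega)
    · have e1 : k - 1 ≠ 0 := by omega
      have e2 : ¬ k - 1 ≤ i := by omega
      simpa [e1, e2] using h1
  let g : ℕ → ℕ × ℕ := fun i => if i = 0 then (k - 1, 0) else if R (c (k - 1)) (c i) then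
    if R (c i) (c 0) then (i - 1, i + 1) else (i, 0) else (k - 1, i)
  have hg : ∀ i < k - 1, (g i).1 < k ∧ (g i).2 < k ∧ ¬ R (c (g i).1) (c (g i).2) := by
    intro i hi
    simp only [g]
    split_ifs with h1 h2 h3
    · exact ⟨by omega, by omega, hclose⟩
    · refine ⟨by omega, by omega, ?_⟩
      have := miss i (by omega) (by omega)
      tauto
    · exact ⟨by omega, by omega, h3⟩
    · exact ⟨by omega, by omega, h2⟩
  have hginj : ∀ i < k - 1, ∀ j < k - 1, g i = g j → i = j := by
    intro i hi j hj h
    simp only [g] at h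
    split_ifs at h <;> simp only [Prod.mk.injEq] at h <;> omega
  rw [← Finset.card_range (k - 1)]
  refine Finset.card_le_card_of_injOn (fun i => (c (g i).1, c (g i).2)) (fun i hi => ?_)
    fun i hi j hj hij => ?_
  · have hi' : i < k - 1 := by simpa using hi
    obtain ⟨h1, h2, h3⟩ := hg i hi'
    simp [hc.mem _ h1, hc.mem _ h2, h3]
  · have hi' : i < k - 1 := by simpa using hi
    have hj' : j < k - 1 := by simpa using hj
    simp only [Prod.mk.injEq] at hij
    obtain ⟨h1, h2, -⟩ := hg i hi'
    obtain ⟨h3, h4, -⟩ := hg j hj'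
    exact hginj i hi' j hj' (Prod.ext (hc.inj _ h1 _ h3 hij.1) (hc.inj _ h2 _ h4 hij.2))

end Semicomplete

/-! ### König's theorem -/

section Konig

open Finset

variable {α β : Type*}

/-- The sets `X` and `Y` form a vertex cover of the bipartite graph with edge set `E`. -/
def IsBipCover (E : Finset (α × β)) (X : Finset α) (Y : Finset β) : Prop :=
  ∀ e ∈ E, e.1 ∈ X ∨ e.2 ∈ Y

/-- By Hall's theorem, one side of a minimum vertex cover can be matched into the complement of the
other side. -/
theorem exists_matching_of_min_cover [DecidableEq α] [DecidableEq β] {E : Finset (α × β)}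
    {X : Finset α} {Y : Finset β} (hc : IsBipCover E X Y)
    (hmin : ∀ X' Y', IsBipCover E X' Y' → X.card + Y.card ≤ X'.card + Y'.card) :
    ∃ f : X → β, Function.Injective f ∧ ∀ x : X, ((x : α), f x) ∈ E ∧ f x ∉ Y := by
  let t : X → Finset β := fun x => (E.filter fun e => e.1 = (x : α) ∧ e.2 ∉ Y).image Prod.snd
  have ht : ∀ x b, b ∈ t x ↔ ((x : α), b) ∈ E ∧ b ∉ Y := by
    intro x b
    simp only [t, mem_image, mem_filter, Prod.exists]
    constructor
    · rintro ⟨a, b, ⟨h, rfl, h'⟩, rfl⟩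
      exact ⟨h, h'⟩
    · rintro ⟨h, h'⟩
      exact ⟨x, b, ⟨h, rfl, h'⟩, rfl⟩
  obtain ⟨f, hf, hft⟩ := (Finset.all_card_le_biUnion_card_iff_exists_injective t).1 fun s => by
    let s' : Finset α := s.map (Function.Embedding.subtype _)
    have hs' : s' ⊆ X := by
      intro a ha
      simp only [s', mem_map, Function.Embedding.subtype_apply] at ha
      obtain ⟨x, -, rfl⟩ := ha
      exact x.2
    have hcov : IsBipCover E (X \ s') (Y ∪ s.biUnion t) := by
      rintro ⟨a, b⟩ he
      rcases hc _ he with h | h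
      · by_cases ha : a ∈ s'
        · by_cases hb : b ∈ Y
          · exact Or.inr (mem_union_left _ hb)
          · simp only [s', mem_map, Function.Embedding.subtype_apply] at ha
            obtain ⟨x, hx, rfl⟩ := ha
            exact Or.inr (mem_union_right _ (mem_biUnion.2 ⟨x, hx, (ht x b).2 ⟨he, hb⟩⟩))
        · exact Or.inl (mem_sdiff.2 ⟨h, ha⟩)
      · exact Or.inr (mem_union_left _ h)
    have h1 := hmin _ _ hcov
    have h2 := card_union_le Y (s.biUnion t)
    have h3 := card_sdiff_add_card_eq_card hs'
    have h4 : s'.card = s.card := card_map _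
    omega
  exact ⟨f, hf, fun x => (ht x _).1 (hft x)⟩

theorem IsBipCover.swap [DecidableEq α] [DecidableEq β] {E : Finset (α × β)} {X : Finset α}
    {Y : Finset β} : IsBipCover (E.image Prod.swap) Y X ↔ IsBipCover E X Y := by
  simp only [IsBipCover, Finset.mem_image, Prod.exists]
  constructor
  · intro h e he
    exact (h e.swap ⟨e.1, e.2, he, rfl⟩).symm
  · rintro h _ ⟨a, b, he, rfl⟩
    exact (h _ he).symm

/-- König's theorem: some vertex cover is minimum, and some matching has the same size. -/
theorem exists_min_cover_and_matching [DecidableEq α] [DecidableEq β] (E : Finset (α × β)) :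
    ∃ X Y M, IsBipCover E X Y ∧
      (∀ X' Y', IsBipCover E X' Y' → X.card + Y.card ≤ X'.card + Y'.card) ∧
      M ⊆ E ∧ Set.InjOn Prod.fst (M : Set (α × β)) ∧ Set.InjOn Prod.snd (M : Set (α × β)) ∧
      M.card = X.card + Y.card := by
  have hex : ∃ n X Y, IsBipCover E X Y ∧ X.card + Y.card = n :=
    ⟨_, E.image Prod.fst, ∅, fun e he => Or.inl (mem_image_of_mem _ he), rfl⟩
  classical
  obtain ⟨X, Y, hc, hn⟩ := Nat.find_spec hex
  have hmin : ∀ X' Y', IsBipCover E X' Y' → X.card + Y.card ≤ X'.card + Y'.card :=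
    fun X' Y' h => hn ▸ Nat.find_min' hex ⟨X', Y', h, rfl⟩
  obtain ⟨f, hf, hfE⟩ := exists_matching_of_min_cover hc hmin
  obtain ⟨g, hg, hgE⟩ := exists_matching_of_min_cover (IsBipCover.swap.2 hc)
    fun X' Y' h => by
      have := hmin Y' X' (IsBipCover.swap.1 h)
      omega
  have hgE' : ∀ y : Y, (g y, (y : β)) ∈ E ∧ g y ∉ X := fun y => by
    refine ⟨?_, (hgE y).2⟩
    obtain ⟨e, he, h⟩ := mem_image.1 (hgE y).1
    rwa [← Prod.swap_swap e, h] at he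
  let u : X ⊕ Y → α × β := Sum.elim (fun x => ((x : α), f x)) fun y => (g y, (y : β))
  have h1 : Function.Injective fun i => (u i).1 := by
    rintro (x | y) (x' | y') h
    · exact congrArg Sum.inl (Subtype.ext h)
    · exact absurd (show (x : α) = g y' from h) fun h => (hgE' y').2 (h ▸ x.2)
    · exact absurd (show g y = (x' : α) from h) fun h => (hgE' y).2 (h ▸ x'.2)
    · exact congrArg Sum.inr (hg h)
  have h2 : Function.Injective fun i => (u i).2 := by
    rintro (x | y) (x' | y') h
    · exact congrArg Sum.inl (hf h)
    · exact absurd (show f x = (y' : β) from h) fun h => (hfE x).2 (h ▸ y'.2)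
    · exact absurd (show (y : β) = f x' from h) fun h => (hfE x').2 (h ▸ y.2)
    · exact congrArg Sum.inr (Subtype.ext h)
  refine ⟨X, Y, univ.image u, hc, hmin, ?_, ?_, ?_, ?_⟩
  · intro e he
    obtain ⟨i | i, -, rfl⟩ := mem_image.1 he
    · exact (hfE i).1
    · exact (hgE' i).1
  · intro e he e' he' h
    obtain ⟨i, -, rfl⟩ := mem_image.1 he
    obtain ⟨j, -, rfl⟩ := mem_image.1 he'
    exact congrArg u (h1 h)
  · intro e he e' he' h
    obtain ⟨i, -, rfl⟩ := mem_image.1 he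
    obtain ⟨j, -, rfl⟩ := mem_image.1 he'
    exact congrArg u (h2 h)
  · rw [card_image_of_injective _ fun i j h => h1 (congrArg Prod.fst h)]
    simp

end Konig

/-! ### Counting the edges of a strong clique with a bipartition -/

section Counting

open Finset

variable {V : Type*} {G : SimpleGraph V}

/-- Every set of neighbours of a vertex has at most `d` elements: the maximum degree is at
most `d`, without reference to finiteness or decidability instances. -/
def DegreeLE (G : SimpleGraph V) (d : ℕ) : Prop :=
  ∀ (v : V) (s : Finset V), (∀ w ∈ s, G.Adj v w) → s.card ≤ d

/-- A set of directed edges of `G` such that no vertex is both a tail and a head, and any two edges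
`a → b` and `a' → b'` satisfy `ab' ∈ E(G)` or `a'b ∈ E(G)`. -/
structure IsCrossing (G : SimpleGraph V) (E : Finset (V × V)) : Prop where
  adj : ∀ e ∈ E, G.Adj e.1 e.2
  ne : ∀ e ∈ E, ∀ f ∈ E, e.1 ≠ f.2
  cross : ∀ e ∈ E, ∀ f ∈ E, G.Adj e.1 f.2 ∨ G.Adj f.1 e.2

/-- The heads of the edges of `E` with tail `a`. -/
def outN [DecidableEq V] (E : Finset (V × V)) (a : V) : Finset V :=
  (E.filter fun e => e.1 = a).image Prod.snd

theorem mem_outN [DecidableEq V] {E : Finset (V × V)} {a b : V} : b ∈ outN E a ↔ (a, b) ∈ E := by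
  simp only [outN, mem_image, mem_filter, Prod.exists]
  constructor
  · rintro ⟨a, b, ⟨h, rfl⟩, rfl⟩
    exact h
  · exact fun h => ⟨a, b, ⟨h, rfl⟩, rfl⟩

theorem card_outN [DecidableEq V] (E : Finset (V × V)) (a : V) :
    (outN E a).card = (E.filter fun e => e.1 = a).card := by
  refine card_image_of_injOn fun e he f hf h => ?_
  rw [mem_coe, mem_filter] at he hf
  exact Prod.ext (he.2.trans hf.2.symm) h

namespace IsCrossing

variable {E M : Finset (V × V)} {k d : ℕ}

theorem swap [DecidableEq V] (C : G.IsCrossing E) : G.IsCrossing (E.image Prod.swap) := by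
  refine ⟨?_, ?_, ?_⟩
  · intro e he
    obtain ⟨e, he', rfl⟩ := mem_image.1 he
    exact (C.adj e he').symm
  · intro e he f hf
    obtain ⟨e, he', rfl⟩ := mem_image.1 he
    obtain ⟨f, hf', rfl⟩ := mem_image.1 hf
    exact (C.ne f hf' e he').symm
  · intro e he f hf
    obtain ⟨e, he', rfl⟩ := mem_image.1 he
    obtain ⟨f, hf', rfl⟩ := mem_image.1 hf
    exact (C.cross e he' f hf').symm.imp G.adj_symm G.adj_symm

/-- A directed `k`-cycle of matching edges in the tournament `e.1 ∼ f.2` yields a `C_{2k}` that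
alternates between matching edges and tournament edges. -/
theorem isContained_of_cycle (C : G.IsCrossing E) (hM : M ⊆ E)
    (h₁ : Set.InjOn Prod.fst (M : Set (V × V))) (h₂ : Set.InjOn Prod.snd (M : Set (V × V)))
    (hk : 0 < k) {x : ℕ → V × V} (hx : IsPathSeq (fun e f => G.Adj e.1 f.2) M k x)
    (hlast : G.Adj (x (k - 1)).1 (x 0).2) : cycleGraph (2 * k) ⊑ G :=
  cycleGraph_isContained_of_alternating hk (fun i => (x i).2) (fun i => (x i).1)
    (fun i hi j hj h => hx.inj i hi j hj (h₂ (hx.mem i hi) (hx.mem j hj) h))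
    (fun i hi j hj h => hx.inj i hi j hj (h₁ (hx.mem i hi) (hx.mem j hj) h))
    (fun i hi j hj h => C.ne _ (hM (hx.mem j hj)) _ (hM (hx.mem i hi)) h.symm)
    (fun i hi => (C.adj _ (hM (hx.mem i hi))).symm) (fun i hi => hx.step i hi) hlast

/-- A directed path on `k + 1` matching edges whose first vertex dominates its last one yields a
`C_{2k}`, which avoids the head of the first edge and the tail of the last one. -/
theorem isContained_of_shortcut (C : G.IsCrossing E) (hM : M ⊆ E)
    (h₁ : Set.InjOn Prod.fst (M : Set (V × V))) (h₂ : Set.InjOn Prod.snd (M : Set (V × V)))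
    (hk : 0 < k) {x : ℕ → V × V} (hx : IsPathSeq (fun e f => G.Adj e.1 f.2) M (k + 1) x)
    (hlast : G.Adj (x 0).1 (x k).2) : cycleGraph (2 * k) ⊑ G :=
  cycleGraph_isContained_of_alternating hk (fun i => (x i).1) (fun i => (x (i + 1)).2)
    (fun i hi j hj h => hx.inj i (by omega) j (by omega)
      (h₁ (hx.mem i (by omega)) (hx.mem j (by omega)) h))
    (fun i hi j hj h => by
      have := hx.inj (i + 1) (by omega) (j + 1) (by omega)
        (h₂ (hx.mem _ (by omega)) (hx.mem _ (by omega)) h)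
      omega)
    (fun i hi j hj h => C.ne _ (hM (hx.mem i (by omega))) _ (hM (hx.mem _ (by omega))) h)
    (fun i hi => hx.step i (by omega))
    (fun i hi => (C.adj _ (hM (hx.mem _ (by omega)))).symm)
    (by simpa [Nat.sub_add_cancel hk] using hlast.symm)

/-- For `k ≥ 3` a matching of `k + 1` edges would contain a `C_{2k}`. -/
theorem card_matching_le (C : G.IsCrossing E) (hk : 3 ≤ k) (hfree : (cycleGraph (2 * k)).Free G)
    (hM : M ⊆ E) (h₁ : Set.InjOn Prod.fst (M : Set (V × V)))
    (h₂ : Set.InjOn Prod.snd (M : Set (V × V))) : M.card ≤ k := by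
  by_contra! hlt
  obtain ⟨M', hM', hcard⟩ := exists_subset_card_eq (show k + 1 ≤ M.card from hlt)
  have hME := hM'.trans hM
  have h₁' := h₁.mono (coe_subset.2 hM')
  have h₂' := h₂.mono (coe_subset.2 hM')
  rcases exists_cycle_or_shortcut_path (R := fun e f : V × V => G.Adj e.1 f.2) hk hcard
    fun e he f hf => C.cross e (hME he) f (hME hf) with ⟨x, hx, h⟩ | ⟨x, hx, h⟩
  · exact hfree (C.isContained_of_cycle hME h₁' h₂' (by omega) hx h)
  · exact hfree (C.isContained_of_shortcut hME h₁' h₂' (by omega) hx h)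

/-- In a `C_4`-free graph three matching edges form a cyclic triangle of the tournament, and there
are no further edges. -/
theorem card_le_of_three_matching (C : G.IsCrossing E) (hfree : (cycleGraph (2 * 2)).Free G)
    (hd : G.DegreeLE d) (hM : M ⊆ E) (h₁ : Set.InjOn Prod.fst (M : Set (V × V)))
    (h₂ : Set.InjOn Prod.snd (M : Set (V × V))) (hcard : 3 ≤ M.card) : E.card + 1 ≤ 2 * d := by
  classical
  obtain ⟨M', hM', hcard'⟩ := exists_subset_card_eq hcard
  have hME := hM'.trans hM
  have h₁' := h₁.mono (coe_subset.2 hM')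
  have h₂' := h₂.mono (coe_subset.2 hM')
  have c4 : ∀ {a a' b b'}, G.Adj a b → G.Adj a b' → G.Adj a' b → G.Adj a' b' → a ≠ a' → b ≠ b' →
      False := by
    intro a a' b b' hab hab' ha'b ha'b' ha hb
    refine hfree (cycleGraph_isContained_of_alternating (k := 2) (by omega)
      (fun i => if i = 0 then a else a') (fun i => if i = 0 then b else b') ?_ ?_ ?_ ?_ ?_ ?_)
    · intro i hi j hj h
      interval_cases i <;> interval_cases j <;> simp_all
    · intro i hi j hj h
      interval_cases i <;> interval_cases j <;> simp_all
    · intro i hi j hj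
      have := hab.ne
      have := hab'.ne
      have := ha'b.ne
      have := ha'b'.ne
      interval_cases i <;> interval_cases j <;> simp_all
    · intro i hi
      interval_cases i <;> simpa
    · intro i hi
      have : i = 0 := by omega
      subst this
      simpa using ha'b.symm
    · simpa using hab'.symm
  obtain ⟨x, hx⟩ := exists_hamilton_path (R := fun e f : V × V => G.Adj e.1 f.2)
    (card_pos.1 (by omega)) fun e he f hf => C.cross e (hME he) f (hME hf)
  rw [hcard'] at hx
  have m0 := hx.mem 0 (by omega)
  have m1 := hx.mem 1 (by omega)
  have m2 := hx.mem 2 (by omega)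
  have s01 : G.Adj (x 0).1 (x 1).2 := hx.step 0 (by omega)
  have s12 : G.Adj (x 1).1 (x 2).2 := hx.step 1 (by omega)
  have s20 : G.Adj (x 2).1 (x 0).2 :=
    (C.cross _ (hME m0) _ (hME m2)).resolve_left fun h =>
      hfree (C.isContained_of_shortcut (k := 2) hME h₁' h₂' (by omega) hx h)
  have inj : ∀ i < 3, ∀ j < 3, i ≠ j → (x i).1 ≠ (x j).1 ∧ (x i).2 ≠ (x j).2 :=
    fun i hi j hj hij => ⟨fun h => hij (hx.inj i hi j hj (h₁' (hx.mem i hi) (hx.mem j hj) h)),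
      fun h => hij (hx.inj i hi j hj (h₂' (hx.mem i hi) (hx.mem j hj) h))⟩
  have i01 := inj 0 (by omega) 1 (by omega) (by omega)
  have i12 := inj 1 (by omega) 2 (by omega) (by omega)
  have i20 := inj 2 (by omega) 0 (by omega) (by omega)
  -- An edge dominating, or dominated by, two consecutive edges of the cyclic triangle is one of them.
  have dom : ∀ {p q r e : V × V}, p ∈ E → q ∈ E → r ∈ E → e ∈ E → G.Adj p.1 q.2 →
      G.Adj q.1 r.2 → G.Adj r.1 p.2 → p.1 ≠ q.1 → p.2 ≠ q.2 → q.1 ≠ r.1 → q.2 ≠ r.2 →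
      r.1 ≠ p.1 → r.2 ≠ p.2 → G.Adj e.1 p.2 → G.Adj e.1 q.2 → e = p := by
    intro p q r e hp hq hr he pq qr rp p1 p2 q1 q2 r1 r2 ep eq
    have e1 : e.1 = p.1 := by
      by_contra hne
      exact c4 ep eq (C.adj p hp) pq hne p2
    refine Prod.ext e1 ?_
    by_contra hne
    have npr : ¬ G.Adj p.1 r.2 := fun h => c4 pq h (C.adj q hq) qr p1 q2
    have re := (C.cross e he r hr).resolve_left (e1 ▸ npr)
    exact c4 (e1 ▸ C.adj e he) (C.adj p hp) re rp r1.symm hne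
  have dom' : ∀ {p q r e : V × V}, p ∈ E → q ∈ E → r ∈ E → e ∈ E → G.Adj p.1 q.2 →
      G.Adj q.1 r.2 → G.Adj r.1 p.2 → p.1 ≠ q.1 → p.2 ≠ q.2 → q.1 ≠ r.1 → q.2 ≠ r.2 →
      r.1 ≠ p.1 → r.2 ≠ p.2 → G.Adj p.1 e.2 → G.Adj q.1 e.2 → e = q := by
    intro p q r e hp hq hr he pq qr rp p1 p2 q1 q2 r1 r2 pe qe
    have e2 : e.2 = q.2 := by
      by_contra hne
      exact c4 pe pq qe (C.adj q hq) p1 hne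
    refine Prod.ext ?_ e2
    by_contra hne
    have nrq : ¬ G.Adj r.1 q.2 := fun h => c4 h (C.adj r hr) (C.adj q hq) qr q1.symm q2
    have er := (C.cross e he r hr).resolve_right (e2 ▸ nrq)
    exact c4 (e2 ▸ C.adj e he) er (C.adj q hq) qr hne q2
  have hsub : E ⊆ {x 0, x 1, x 2} := by
    intro e he
    simp only [mem_insert, mem_singleton]
    have E0 := hME m0
    have E1 := hME m1
    have E2 := hME m2
    have t01 := dom E0 E1 E2 he s01 s12 s20 i01.1 i01.2 i12.1 i12.2 i20.1 i20.2
    have t12 := dom E1 E2 E0 he s12 s20 s01 i12.1 i12.2 i20.1 i20.2 i01.1 i01.2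
    have t20 := dom E2 E0 E1 he s20 s01 s12 i20.1 i20.2 i01.1 i01.2 i12.1 i12.2
    have t01' := dom' E0 E1 E2 he s01 s12 s20 i01.1 i01.2 i12.1 i12.2 i20.1 i20.2
    have t12' := dom' E1 E2 E0 he s12 s20 s01 i12.1 i12.2 i20.1 i20.2 i01.1 i01.2
    have t20' := dom' E2 E0 E1 he s20 s01 s12 i20.1 i20.2 i01.1 i01.2 i12.1 i12.2
    have c0 := C.cross e he _ E0
    have c1 := C.cross e he _ E1
    have c2 := C.cross e he _ E2
    rcases c0 with c0 | c0 <;> rcases c1 with c1 | c1 <;> rcases c2 with c2 | c2 <;>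
      first
        | exact Or.inl (t01 c0 c1)
        | exact Or.inr (Or.inl (t12 c1 c2))
        | exact Or.inr (Or.inr (t20 c2 c0))
        | exact Or.inr (Or.inl (t01' c0 c1))
        | exact Or.inr (Or.inr (t12' c1 c2))
        | exact Or.inl (t20' c2 c0)
  have hE := (card_le_card hsub).trans card_le_three
  have hd2 : 2 ≤ d := by
    have := hd (x 0).1 {(x 0).2, (x 1).2} (by
      simp only [mem_insert, mem_singleton]
      rintro w (rfl | rfl)
      · exact C.adj _ (hME m0)
      · exact s01)
    rwa [card_pair i01.2] at this
  omega

variable [DecidableEq V]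

theorem card_outN_le (C : G.IsCrossing E) (hd : G.DegreeLE d) (a : V) : (outN E a).card ≤ d :=
  hd a _ fun _ hw => C.adj _ (mem_outN.1 hw)

/-- A tail of full degree is joined within `E` to all heads: if `a` were not joined to the head `b'`
of `a' → b'`, then `a'` would be adjacent to `b'` and to all `d` neighbours of `a`. -/
theorem mem_of_full (C : G.IsCrossing E) (hd : G.DegreeLE d) {a : V} (ha : (outN E a).card = d)
    {e : V × V} (he : e ∈ E) : (a, e.2) ∈ E := by
  by_contra hne
  have hnot : e.2 ∉ outN E a := fun h => hne (mem_outN.1 h)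
  have hcard : (insert e.2 (outN E a)).card = d + 1 := by rw [card_insert_of_notMem hnot, ha]
  by_cases hadj : G.Adj a e.2
  · have := hd a (insert e.2 (outN E a)) fun w hw => by
      rcases mem_insert.1 hw with rfl | hw
      · exact hadj
      · exact C.adj _ (mem_outN.1 hw)
    omega
  · have := hd e.1 (insert e.2 (outN E a)) fun w hw => by
      rcases mem_insert.1 hw with rfl | hw
      · exact C.adj e he
      · exact (C.cross _ (mem_outN.1 hw) e he).resolve_left hadj
    omega

/-- A set `X` of tails covers at most `|X| d` edges, less one for each tail of `X` that is not full. -/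
theorem card_filter_fst_add_le (C : G.IsCrossing E) (hd : G.DegreeLE d) (X : Finset V) :
    (E.filter fun e => e.1 ∈ X).card + X.card ≤
      X.card * d + (X.filter fun a => (outN E a).card = d).card := by
  have h1 : (E.filter fun e => e.1 ∈ X).card = ∑ a ∈ X, (outN E a).card := by
    rw [card_eq_sum_card_fiberwise (f := Prod.fst) (t := X) fun e he => by
      simpa using (mem_filter.1 he).2]
    refine sum_congr rfl fun a ha => ?_
    rw [card_outN, filter_filter]
    congr 1
    refine filter_congr fun e _ => ?_
    constructor
    · exact fun h => h.2
    · rintro rfl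
      exact ⟨ha, rfl⟩
  rw [h1, card_filter, card_eq_sum_ones, ← sum_add_distrib, sum_mul, ← sum_add_distrib]
  refine sum_le_sum fun a _ => ?_
  have := C.card_outN_le hd a
  split_ifs <;> omega

/-- The bound for a vertex cover contained in the set of tails. -/
theorem card_le_of_one_sided_cover (C : G.IsCrossing E) (hd : G.DegreeLE d) (hd1 : 1 ≤ d)
    (hk : 2 ≤ k) (hfree : (cycleGraph (2 * k)).Free G) {X : Finset V} (hX : IsBipCover E X ∅)
    (hM : M ⊆ E) (h₁ : Set.InjOn Prod.fst (M : Set (V × V)))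
    (h₂ : Set.InjOn Prod.snd (M : Set (V × V))) (hMX : M.card = X.card) (hXk : X.card ≤ k) :
    E.card + (k - 1) ≤ k * d := by
  have hfst : ∀ e ∈ E, e.1 ∈ X := fun e he => (hX e he).resolve_right (notMem_empty _)
  have hsum := C.card_filter_fst_add_le hd X
  rw [filter_true_of_mem hfst] at hsum
  obtain ⟨k, rfl⟩ : ∃ k', k = k' + 1 := ⟨k - 1, by omega⟩
  obtain ⟨d, rfl⟩ : ∃ d', d = d' + 1 := ⟨d - 1, by omega⟩
  rcases eq_empty_or_nonempty (X.filter fun a => (outN E a).card = d + 1) with h | ⟨a, ha⟩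
  · rw [h, card_empty] at hsum
    have : X.card * d ≤ (k + 1) * d := Nat.mul_le_mul_right _ hXk
    simp only [Nat.add_sub_cancel]
    nlinarith
  · -- A tail `a` of full degree: all edges lie between `X` and the `d + 1` heads at `a`.
    have ha' := (mem_filter.1 ha).2
    have hsub : E ⊆ X ×ˢ outN E a := fun e he =>
      mem_product.2 ⟨hfst e he, mem_outN.2 (C.mem_of_full hd ha' he)⟩
    have hMN : M.card ≤ d + 1 := by
      rw [← card_image_of_injOn h₂, ← ha']
      refine card_le_card fun b hb => ?_
      obtain ⟨e, he, rfl⟩ := mem_image.1 hb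
      exact mem_outN.2 (C.mem_of_full hd ha' (hM he))
    have hcard := card_le_card hsub
    rw [card_product, ha'] at hcard
    rcases Nat.lt_or_ge X.card (k + 1) with hlt | hge
    · simp only [Nat.add_sub_cancel]
      rcases Nat.eq_zero_or_pos X.card with h0 | hpos
      · rw [h0] at hcard
        nlinarith
      · have hXd : X.card ≤ d + 1 := by omega
        have hXk' : X.card ≤ k := by omega
        have : X.card * d ≤ k * d := Nat.mul_le_mul_right _ hXk'
        nlinarith
    · have hXeq : X.card = k + 1 := by omega
      classical
      have hmiss := card_not_rel_of_no_hamilton_cycle (R := fun e f : V × V => G.Adj e.1 f.2) hk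
        (hMX.trans hXeq) (fun e he f hf => C.cross e (hM he) f (hM hf))
        fun x hx h => hfree (C.isContained_of_cycle hM h₁ h₂ (by omega) hx h)
      -- Non-adjacent pairs of matching edges give pairs of `X × N` that are not in `E`.
      have hle : ((M ×ˢ M).filter fun p => ¬ G.Adj p.1.1 p.2.2).card ≤
          ((X ×ˢ outN E a) \ E).card := by
        refine card_le_card_of_injOn (fun p => (p.1.1, p.2.2)) (fun p hp => ?_)
          fun p hp q hq hpq => ?_
        · rw [mem_coe, mem_filter, mem_product] at hp
          exact mem_sdiff.2 ⟨mem_product.2 ⟨hfst p.1 (hM hp.1.1),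
            mem_outN.2 (C.mem_of_full hd ha' (e := p.2) (hM hp.1.2))⟩, fun h => hp.2 (C.adj _ h)⟩
        · rw [mem_coe, mem_filter, mem_product] at hp hq
          simp only [Prod.mk.injEq] at hpq
          exact Prod.ext (h₁ hp.1.1 hq.1.1 hpq.1) (h₂ hp.1.2 hq.1.2 hpq.2)
      have htot := card_sdiff_add_card_eq_card hsub
      rw [card_product, ha', hXeq] at htot
      omega

/-- The bound for a minimum vertex cover with vertices on both sides. -/
theorem card_le_of_two_sided_cover (C : G.IsCrossing E) (hd : G.DegreeLE d) (hd1 : 1 ≤ d)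
    {X Y : Finset V} (hc : IsBipCover E X Y)
    (hmin : ∀ X' Y', IsBipCover E X' Y' → X.card + Y.card ≤ X'.card + Y'.card)
    (hX : X.Nonempty) (hY : Y.Nonempty) (hXk : X.card + Y.card ≤ k) :
    E.card + (k - 1) ≤ k * d := by
  obtain ⟨x₀, hx₀⟩ := hX
  obtain ⟨y₀, hy₀⟩ := hY
  set E' := E.image Prod.swap with hE'
  have C' : G.IsCrossing E' := C.swap
  have memE' : ∀ a b, (a, b) ∈ E' ↔ (b, a) ∈ E := by
    intro a b
    simp only [hE', mem_image, Prod.exists, Prod.swap_prod_mk, Prod.mk.injEq]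
    constructor
    · rintro ⟨b, a, h, rfl, rfl⟩
      exact h
    · exact fun h => ⟨b, a, h, rfl, rfl⟩
  have h1 := C.card_filter_fst_add_le hd X
  have h2 := C'.card_filter_fst_add_le hd Y
  set p := X.filter fun a => (outN E a).card = d
  set q := Y.filter fun b => (outN E' b).card = d
  have h3 : (E'.filter fun e => e.1 ∈ Y).card = (E.filter fun e => e.2 ∈ Y).card := by
    rw [hE', filter_image, card_image_of_injective _ Prod.swap_injective]
    rfl
  -- By minimality of the cover every vertex of the cover is on an edge.
  obtain ⟨e, he, hey⟩ : ∃ e ∈ E, e.2 = y₀ := by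
    by_contra! hno
    have := hmin X (Y.erase y₀) fun e he =>
      (hc e he).imp id fun h => mem_erase.2 ⟨hno e he, h⟩
    have := card_erase_lt_of_mem hy₀
    omega
  obtain ⟨f, hf, hfx⟩ : ∃ f ∈ E, f.1 = x₀ := by
    by_contra! hno
    have := hmin (X.erase x₀) Y fun e he =>
      (hc e he).imp (fun h => mem_erase.2 ⟨hno e he, h⟩) id
    have := card_erase_lt_of_mem hx₀
    omega
  -- The edges counted twice include a star at `y₀` with the full tails and one at `x₀` with the
  -- full heads; these share at most the edge from `x₀` to `y₀`.
  have h4 : p.card + q.card ≤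
      ((E.filter fun e => e.1 ∈ X) ∩ E.filter fun e => e.2 ∈ Y).card + 1 := by
    have hA : p.image (fun a => (a, y₀)) ∪ q.image (fun b => (x₀, b)) ⊆
        (E.filter fun e => e.1 ∈ X) ∩ E.filter fun e => e.2 ∈ Y := by
      intro g hg
      rcases mem_union.1 hg with hg | hg
      · obtain ⟨a, ha, rfl⟩ := mem_image.1 hg
        obtain ⟨haX, had⟩ := mem_filter.1 ha
        have : (a, y₀) ∈ E := hey ▸ C.mem_of_full hd had he
        exact mem_inter.2 ⟨mem_filter.2 ⟨this, haX⟩, mem_filter.2 ⟨this, hy₀⟩⟩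
      · obtain ⟨b, hb, rfl⟩ := mem_image.1 hg
        obtain ⟨hbY, hbd⟩ := mem_filter.1 hb
        have : (b, x₀) ∈ E' := by
          have := C'.mem_of_full hd hbd (e := (f.2, f.1)) ((memE' _ _).2 hf)
          rwa [hfx] at this
        have := (memE' _ _).1 this
        exact mem_inter.2 ⟨mem_filter.2 ⟨this, hx₀⟩, mem_filter.2 ⟨this, hbY⟩⟩
    have hB := card_union_add_card_inter (p.image fun a => (a, y₀)) (q.image fun b => (x₀, b))
    have hI : (p.image (fun a => (a, y₀)) ∩ q.image (fun b => (x₀, b))).card ≤ 1 := by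
      refine card_le_one.2 fun g hg g' hg' => ?_
      have key : ∀ g ∈ p.image (fun a => (a, y₀)) ∩ q.image (fun b => (x₀, b)), g = (x₀, y₀) := by
        intro g hg
        obtain ⟨hg1, hg2⟩ := mem_inter.1 hg
        obtain ⟨a, -, rfl⟩ := mem_image.1 hg1
        obtain ⟨b, -, hb⟩ := mem_image.1 hg2
        simp only [Prod.mk.injEq] at hb
        rw [hb.1]
      rw [key g hg, key g' hg']
    rw [card_image_of_injective _ fun a b h => congrArg Prod.fst h,
      card_image_of_injective _ fun a b h => congrArg Prod.snd h] at hB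
    have := card_le_card hA
    omega
  have h5 : (E.filter fun e => e.1 ∈ X) ∪ E.filter (fun e => e.2 ∈ Y) = E := by
    rw [← filter_or]
    exact filter_true_of_mem hc
  have h6 := card_union_add_card_inter (E.filter fun e => e.1 ∈ X) (E.filter fun e => e.2 ∈ Y)
  rw [h5] at h6
  rw [h3] at h2
  have hXpos : 0 < X.card := card_pos.2 ⟨x₀, hx₀⟩
  obtain ⟨d, rfl⟩ : ∃ d', d = d' + 1 := ⟨d - 1, by omega⟩
  have h7 : (X.card + Y.card) * d ≤ k * d := Nat.mul_le_mul_right _ hXk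
  have h8 : k - 1 + 1 = k := by omega
  nlinarith

/-- A strong clique with a bipartition in a `C_{2k}`-free graph of maximum degree at most `d` has at
most `k d - (k - 1)` edges. -/
theorem card_add_le (C : G.IsCrossing E) (hd : G.DegreeLE d) (hd1 : 1 ≤ d) (hk : 2 ≤ k)
    (hfree : (cycleGraph (2 * k)).Free G) : E.card + (k - 1) ≤ k * d := by
  obtain ⟨X, Y, M, hc, hmin, hM, h₁, h₂, hcard⟩ := exists_min_cover_and_matching E
  by_cases hMk : M.card ≤ k
  · rcases Y.eq_empty_or_nonempty with rfl | hY
    · exact C.card_le_of_one_sided_cover hd hd1 hk hfree hc hM h₁ h₂ (by simpa using hcard)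
        (by simpa [hcard] using hMk)
    rcases X.eq_empty_or_nonempty with rfl | hX
    · have h₁' : Set.InjOn Prod.fst ((M.image Prod.swap : Finset (V × V)) : Set (V × V)) := by
        rintro _ he _ hf h
        obtain ⟨e, he', rfl⟩ := mem_image.1 (mem_coe.1 he)
        obtain ⟨f, hf', rfl⟩ := mem_image.1 (mem_coe.1 hf)
        rw [h₂ he' hf' h]
      have h₂' : Set.InjOn Prod.snd ((M.image Prod.swap : Finset (V × V)) : Set (V × V)) := by
        rintro _ he _ hf h
        obtain ⟨e, he', rfl⟩ := mem_image.1 (mem_coe.1 he)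
        obtain ⟨f, hf', rfl⟩ := mem_image.1 (mem_coe.1 hf)
        rw [h₁ he' hf' h]
      have := C.swap.card_le_of_one_sided_cover (M := M.image Prod.swap) hd hd1 hk hfree
        (IsBipCover.swap.2 hc) (image_subset_image hM) h₁' h₂'
        (by rw [card_image_of_injective _ Prod.swap_injective]; simpa using hcard)
        (by simpa [hcard] using hMk)
      rwa [card_image_of_injective _ Prod.swap_injective] at this
    · exact C.card_le_of_two_sided_cover hd hd1 hc hmin hX hY (hcard ▸ hMk)
  · rcases Nat.lt_or_ge 2 k with h | h
    · exact absurd (C.card_matching_le h hfree hM h₁ h₂) hMk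
    · obtain rfl : k = 2 := by omega
      exact C.card_le_of_three_matching hfree hd hM h₁ h₂ (by omega)

end IsCrossing

end Counting

/-! ### From strong cliques to edge relations -/

variable {V : Type*} {G : SimpleGraph V}

/-- Two edges at distance at most two in the line graph share a vertex or are joined by an edge. -/
theorem exists_mem_eq_or_adj_of_edist_le_two {e f : G.edgeSet} (h : G.lineGraph.edist e f ≤ 2) :
    ∃ a ∈ (e : Sym2 V), ∃ b ∈ (f : Sym2 V), a = b ∨ G.Adj a b := by
  have hne : G.lineGraph.edist e f ≠ ⊤ := fun h' => by simp [h'] at h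
  obtain ⟨p, hp⟩ := exists_walk_of_edist_ne_top hne
  rw [← hp] at h
  have hlen : p.length ≤ 2 := by exact_mod_cast h
  have refl : ∀ e : G.edgeSet, ∃ a, a ∈ (e : Sym2 V) := by
    rintro ⟨e, -⟩
    induction e with
    | h x y => exact ⟨x, Sym2.mem_mk_left x y⟩
  match p, hlen with
  | .nil, _ =>
    obtain ⟨a, ha⟩ := refl e
    exact ⟨a, ha, a, ha, Or.inl rfl⟩
  | .cons h₁ .nil, _ =>
    obtain ⟨-, a, ha, ha'⟩ := lineGraph_adj_iff_exists.1 h₁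
    exact ⟨a, ha, a, ha', Or.inl rfl⟩
  | .cons (v := g) h₁ (.cons h₂ .nil), _ =>
    obtain ⟨-, a, ha, ha'⟩ := lineGraph_adj_iff_exists.1 h₁
    obtain ⟨-, b, hb, hb'⟩ := lineGraph_adj_iff_exists.1 h₂
    refine ⟨a, ha, b, hb', ?_⟩
    by_cases hab : a = b
    · exact Or.inl hab
    · have hg := (Sym2.mem_and_mem_iff hab).1 ⟨ha', hb⟩
      have := g.2
      rw [hg] at this
      exact Or.inr this
  | .cons _ (.cons _ (.cons _ q)), h => simp at h

/-- The relation on vertices that holds for the ends of the edges in `S`. -/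
def edgeRel (S : Finset G.edgeSet) (u v : V) : Prop :=
  ∃ e ∈ S, (e : Sym2 V) = s(u, v)

theorem IsStrongClique.isStrongCliqueRel {S : Finset G.edgeSet} (hS : G.IsStrongClique S) :
    G.IsStrongCliqueRel (edgeRel S) := by
  refine ⟨?_, ?_, ?_⟩
  · rintro u v ⟨e, he, h⟩
    exact ⟨e, he, h.trans Sym2.eq_swap⟩
  · rintro u v ⟨e, -, h⟩
    have := e.2
    rwa [h] at this
  · rintro u v x y ⟨e, he, h⟩ ⟨f, hf, h'⟩
    obtain ⟨a, ha, b, hb, hab⟩ := exists_mem_eq_or_adj_of_edist_le_two (hS e he f hf)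
    rw [h, Sym2.mem_iff] at ha
    rw [h', Sym2.mem_iff] at hb
    rcases ha with rfl | rfl <;> rcases hb with rfl | rfl <;> tauto

variable [Fintype V]

theorem card_add_le_of_hasBipartition {S : Finset G.edgeSet} (hS : G.IsStrongCliqueRel (edgeRel S))
    (hB : G.HasBipartition (edgeRel S)) {k d : ℕ} (hd : G.DegreeLE d) (hd1 : 1 ≤ d) (hk : 2 ≤ k)
    (hfree : (cycleGraph (2 * k)).Free G) : S.card + (k - 1) ≤ k * d := by
  classical
  obtain ⟨O, hOP, hPO, hO⟩ := hB
  let E : Finset (V × V) := Finset.univ.filter fun p => O p.1 p.2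
  have hE : ∀ e, e ∈ E ↔ O e.1 e.2 := by simp [E]
  have C : G.IsCrossing E :=
    ⟨fun e he => hS.adj (hOP _ _ ((hE e).1 he)),
      fun e he f hf => (hO _ _ _ _ ((hE e).1 he) ((hE f).1 hf)).1,
      fun e he f hf => (hO _ _ _ _ ((hE e).1 he) ((hE f).1 hf)).2⟩
  have hcard : S.card ≤ E.card := by
    rw [← Finset.card_map (Function.Embedding.subtype _)]
    refine (Finset.card_le_card (t := E.image fun p => s(p.1, p.2)) fun e he => ?_).trans
      Finset.card_image_le
    obtain ⟨⟨e, he'⟩, heS, rfl⟩ := Finset.mem_map.1 he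
    induction e with
    | h u v =>
      rcases hPO u v ⟨⟨s(u, v), he'⟩, heS, rfl⟩ with h | h
      · exact Finset.mem_image.2 ⟨(u, v), (hE _).2 h, rfl⟩
      · exact Finset.mem_image.2 ⟨(v, u), (hE _).2 h, Sym2.eq_swap⟩
  have := C.card_add_le hd hd1 hk hfree
  omega

/-- Each leaf of a covering star contributes at most `Δ - 1` edges beyond those at its centre. -/
theorem card_add_le_of_starCover [DecidableRel G.Adj] {S : Finset G.edgeSet}
    (hB : G.StarCover (edgeRel S)) : S.card + 3 ≤ 4 * G.maxDegree := by
  classical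
  obtain ⟨c, p, q, r, hp, hq, hr, hcov⟩ := hB
  have hleaf : ∀ w, G.Adj c w →
      ((G.incidenceFinset w).erase s(c, w)).card + 1 ≤ G.maxDegree := by
    intro w hw
    have hmem : s(c, w) ∈ G.incidenceFinset w := by
      rw [mem_incidenceFinset]
      exact ⟨hw, Sym2.mem_mk_right c w⟩
    rw [Finset.card_erase_add_one hmem, card_incidenceFinset_eq_degree]
    exact G.degree_le_maxDegree w
  have hc : (G.incidenceFinset c).card ≤ G.maxDegree := by
    rw [card_incidenceFinset_eq_degree]
    exact G.degree_le_maxDegree c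
  have hsub : S.map (Function.Embedding.subtype _) ⊆
      G.incidenceFinset c ∪ ((G.incidenceFinset p).erase s(c, p) ∪
        ((G.incidenceFinset q).erase s(c, q) ∪ (G.incidenceFinset r).erase s(c, r))) := by
    intro e he
    obtain ⟨⟨e, he'⟩, heS, rfl⟩ := Finset.mem_map.1 he
    by_cases hce : c ∈ e
    · exact Finset.mem_union_left _ ((mem_incidenceFinset _ _ _).2 ⟨he', hce⟩)
    have hin : ∀ w, w ∈ e → e ∈ (G.incidenceFinset w).erase s(c, w) := fun w hw =>
      Finset.mem_erase.2 ⟨fun h => hce (h ▸ Sym2.mem_mk_left c w),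
        (mem_incidenceFinset _ _ _).2 ⟨he', hw⟩⟩
    have hmem : p ∈ e ∨ q ∈ e ∨ r ∈ e := by
      induction e with
      | h u v =>
        have := hcov u v ⟨⟨s(u, v), he'⟩, heS, rfl⟩
        simp only [Sym2.mem_iff] at hce ⊢
        grind
    simp only [Finset.mem_union, Function.Embedding.subtype_apply]
    rcases hmem with h | h | h
    · exact Or.inr (Or.inl (hin p h))
    · exact Or.inr (Or.inr (Or.inl (hin q h)))
    · exact Or.inr (Or.inr (Or.inr (hin r h)))
  have h1 := Finset.card_le_card hsub
  rw [Finset.card_map] at h1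
  have h2 := Finset.card_union_le (G.incidenceFinset c) ((G.incidenceFinset p).erase s(c, p) ∪
    ((G.incidenceFinset q).erase s(c, q) ∪ (G.incidenceFinset r).erase s(c, r)))
  have h3 := Finset.card_union_le ((G.incidenceFinset p).erase s(c, p))
    ((G.incidenceFinset q).erase s(c, q) ∪ (G.incidenceFinset r).erase s(c, r))
  have h4 := Finset.card_union_le ((G.incidenceFinset q).erase s(c, q))
    ((G.incidenceFinset r).erase s(c, r))
  have := hleaf p hp
  have := hleaf q hq
  have := hleaf r hr
  omega

theorem degreeLE_maxDegree [DecidableRel G.Adj] : G.DegreeLE G.maxDegree := by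
  intro v s hs
  have hsub : s ⊆ G.neighborFinset v := fun w hw => (G.mem_neighborFinset v w).2 (hs w hw)
  exact (Finset.card_le_card hsub).trans (G.degree_le_maxDegree v)

end SimpleGraph

theorem mainTheorem2 {V : Type*} [Fintype V] (G : SimpleGraph V) [DecidableRel G.Adj]
    (k : ℕ) (hk : 2 ≤ k)
    (hC5 : (SimpleGraph.cycleGraph 5).Free G)
    (hC2k : (SimpleGraph.cycleGraph (2 * k)).Free G)
    (hdeg : 1 ≤ G.maxDegree) :
    (4 ≤ k → (G.strongCliqueNum : ℤ) ≤ (k : ℤ) * (G.maxDegree : ℤ) - ((k : ℤ) - 1)) ∧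
    (k = 2 ∨ k = 3 → (SimpleGraph.cycleGraph 3).Free G →
      (G.strongCliqueNum : ℤ) ≤ (k : ℤ) * (G.maxDegree : ℤ) - ((k : ℤ) - 1)) := by
  obtain ⟨⟨S, hS, hcard⟩, -⟩ := G.strongCliqueNum_isGreatest
  have hP := hS.isStrongCliqueRel
  have hbip : G.HasBipartition (SimpleGraph.edgeRel S) →
      (G.strongCliqueNum : ℤ) ≤ (k : ℤ) * (G.maxDegree : ℤ) - ((k : ℤ) - 1) := by
    intro hB
    have h := SimpleGraph.card_add_le_of_hasBipartition hP hB SimpleGraph.degreeLE_maxDegree hdeg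
      hk hC2k
    rw [hcard] at h
    zify [show 1 ≤ k by omega] at h
    linarith
  rcases hP.hasBipartition_or_starCover hC5 with hB | ⟨hB, a, b, c, hab, hbc, hca⟩
  · exact ⟨fun _ => hbip hB, fun _ _ => hbip hB⟩
  · refine ⟨fun hk4 => ?_, fun _ hC3 => (hC3.no_triangle hab hbc hca).elim⟩
    have h := SimpleGraph.card_add_le_of_starCover hB
    rw [hcard] at h
    zify at h hk4 hdeg
    -- `4 Δ - 3 ≤ k Δ - (k - 1)` amounts to `(k - 4) (Δ - 1) ≥ 0`.
    nlinarith [mul_nonneg (sub_nonneg.2 hk4) (sub_nonneg.2 hdeg)]
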